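/- **Setting.** $K\ge1$ sensors observe $y_t^k=x h_t^k+w_t^k$, $t=1,2,\dots$, $k=1,\dots,K$, where $x\in\mathbb C$ is a non-random parameter, the noise variables $w_t^k\sim\mathcal N_c(0,\sigma_k^2)$ (circularly symmetric, $\sigma_k>0$) are independent over $t$ and $k$, the channel gains $h_t^k$ are i.i.d. over $t$ for each $k$, and the channels are independent of the noise. Assume (A1) $0<|\Re x|,|\Im x|<\infty$ and (A2) $0<|h_t^k|<\infty$ for all $k,t$ (almost surely). Put $$U_t^k=\sum_{\tau=1}^t\frac{2|h_\tau^k|^2}{\sigma_k^2},\qquad V_t^k=\sum_{\tau=1}^t\frac{2\Re\big((h_\tau^k)^*y_\tau^k\big)}{\sigma_k^2},\qquad I_t^c=U_t=\sum_{k=1}^K U_t^k ;$$ $I_t^c$ is the conditional Fisher information for $\Re x$ given the channels. **The estimator LT-sDMLE** with target information $\mathcal I$, thresholds $e_k$, numbers of bits $r_U$ and $R_k$, and quantizer range parameters $\theta_k,\varphi_k>0$ that do not depend on $\mathcal I$. A mid-riser quantizer with $N$ levels on an interval divides it into $N$ equal cells, maps a value in the interval to the midpoint of its cell, and a value outside to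 the closest level. Sensor $k$ samples at $t_0^k=0$, $t_n^k=\min\{t>t_{n-1}^k:U_t^k-U_{t_{n-1}^k}^k\ge e_k\}$. The overshoot $p_n^k=U_{t_n^k}^k-U_{t_{n-1}^k}^k-e_k$ is quantized to $\tilde p_n^k$ by the mid-riser quantizer with $2^{r_U}$ levels on $[0,\theta_k]$. With $M_t^k$ the number of $n\ge1$ such that $t_n^k\le t$, put $$\tilde U_t=\sum_{k=1}^K\sum_{n=1}^{M_t^k}(e_k+\tilde p_n^k),\qquad \tilde{\mathcal T}=\min\{t:\tilde U_t\ge\mathcal I\}.$$ At time $\tilde{\mathcal T}$ sensor $k$ quantizes $V_{\tilde{\mathcal T}}^k$ to $\tilde V_{\tilde{\mathcal T}}^k$ by the mid-riser quantizer with $2^{R_k}$ levels on $[-\tilde{\mathcal T}\varphi_k,\tilde{\mathcal T}\varphi_k]$, and the estimate of $\Re x$ is $\tilde x_{\tilde{\mathcal T}}=\sum_k\tilde V_{\tilde{\mathcal T}}^k/\tilde U_{\tilde{\mathcal T}}$. Let $\mathcal H_{\tilde{\mathcal T}}$ be the channel gains up to time $\tilde{\mathcal T}$. As part of the design, the quantizer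 ranges are such that, for all sufficiently large $\mathcal I$, all $k$ and all $n\ge1$, $$\mathsf E\big[|\tilde p_n^k-p_n^k|\big]<\frac{\theta_k}{2^{r_U+1}}\qquad\text{and}\qquad \mathsf E\big[|\tilde V_{\tilde{\mathcal T}}^k-V_{\tilde{\mathcal T}}^k|\,\big|\,\mathcal H_{\tilde{\mathcal T}}\big]<\frac{\tilde{\mathcal T}\varphi_k}{2^{R_k}}\ \text{ almost surely.}$$ **Theorem.** Let $\mathcal I\to\infty$ along an arbitrary sequence of targets, with $e_k,r_U,R_k$ depending on the target so that, for every $k$, $R_k=\omega(\log\mathcal I)$, $e_k\to\infty$ with $e_k=o(\sqrt{\mathcal I})$, and $r_U=\omega(\log(\sqrt{\mathcal I}/e_k))$. Then LT-sDMLE is asymptotically optimal conditionally on the channels: almost surely, the conditional law of $\sqrt{I^c_{\tilde{\mathcal T}}}\,(\tilde x_{\tilde{\mathcal T}}-\Re x)$ given $\mathcal H_{\tilde{\mathcal T}}$ converges weakly to $\mathcal N(0,1)$. -/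

import Mathlib

open MeasureTheory ProbabilityTheory Filter Topology Asymptotics
open scoped NNReal ENNReal

noncomputable section

namespace LTsDMLE

/-- The circularly symmetric complex Gaussian law `N_c(0, v)`: real and imaginary parts are
independent, each with law `N(0, v / 2)`. -/
def complexGaussian (v : ℝ≥0) : Measure ℂ :=
  ((gaussianReal 0 (v / 2)).prod (gaussianReal 0 (v / 2))).map
    (fun p : ℝ × ℝ => (⟨p.1, p.2⟩ : ℂ))

/-- Mid-riser uniform quantizer: the interval `[lo, lo + len]` is divided into `N` cells of equal
length, a value is mapped to the midpoint of its cell, and a value outside the interval to the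
closest of the `N` levels. -/
def midRiser (lo len : ℝ) (N : ℕ) (v : ℝ) : ℝ :=
  lo + (((max 0 (min ((N : ℤ) - 1) ⌊(v - lo) / (len / N)⌋) : ℤ) : ℝ) + 1 / 2) * (len / N)

/-! ### Level-triggered sampling of a real path `U` with threshold `e` -/

/-- Sampling times: `t₀ = 0` and
`tₙ₊₁ = min {t > tₙ : U t - U tₙ ≥ e}`. -/
def sampleTime (U : ℕ → ℝ) (e : ℝ) : ℕ → ℕ
  | 0 => 0
  | n + 1 => sInf {t : ℕ | sampleTime U e n < t ∧ e ≤ U t - U (sampleTime U e n)}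

/-- The number of messages sent up to time `t`, i.e. the number of `n ≥ 1` with `tₙ ≤ t`
(recall `n ≤ tₙ`). -/
def messageCount (U : ℕ → ℝ) (e : ℝ) (t : ℕ) : ℕ :=
  ((Finset.Icc 1 t).filter (fun n => sampleTime U e n ≤ t)).card

/-- The `n`-th overshoot (`n ≥ 1`), `U (tₙ) - U (tₙ₋₁) - e`. -/
def overshoot (U : ℕ → ℝ) (e : ℝ) (n : ℕ) : ℝ :=
  U (sampleTime U e n) - U (sampleTime U e (n - 1)) - e

/-- The `n`-th overshoot quantized with `r` bits on `[0, θ]`. -/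
def quantOvershoot (U : ℕ → ℝ) (e θ : ℝ) (r n : ℕ) : ℝ :=
  midRiser 0 θ (2 ^ r) (overshoot U e n)

/-- The approximation of the path `U` at time `t` recovered from the messages. -/
def recovered (U : ℕ → ℝ) (e θ : ℝ) (r t : ℕ) : ℝ :=
  ∑ n ∈ Finset.Icc 1 (messageCount U e t), (e + quantOvershoot U e θ r n)

/-! ### The local statistics of the `K` sensors

`H k τ`, `W k τ` are the channel gain and the noise of sensor `k` at time `τ + 1`, so that a sum
over `τ < t` runs over the times `1, …, t`. The noise variance of sensor `k` is `σ k ^ 2`. -/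

variable {K : ℕ}

/-- The observation of sensor `k` at time `τ + 1`. -/
def obs (x : ℂ) (H W : Fin K → ℕ → ℂ) (k : Fin K) (τ : ℕ) : ℂ :=
  x * H k τ + W k τ

/-- The local observed Fisher information `U_t^k`. -/
def localU (σ : Fin K → ℝ) (H : Fin K → ℕ → ℂ) (k : Fin K) (t : ℕ) : ℝ :=
  ∑ τ ∈ Finset.range t, 2 * ‖H k τ‖ ^ 2 / σ k ^ 2

/-- The local statistic `V_t^k` (for the real part of the parameter). -/
def localV (σ : Fin K → ℝ) (x : ℂ) (H W : Fin K → ℕ → ℂ) (k : Fin K) (t : ℕ) : ℝ :=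
  ∑ τ ∈ Finset.range t, 2 * (starRingEnd ℂ (H k τ) * obs x H W k τ).re / σ k ^ 2

/-- The conditional Fisher information `I_t^c` given the channels. -/
def condFisherInfo (σ : Fin K → ℝ) (H : Fin K → ℕ → ℂ) (t : ℕ) : ℝ :=
  ∑ k, localU σ H k t

/-! ### The estimator -/

/-- The design parameters of the scheme. -/
structure Design (K : ℕ) where
  /-- target Fisher information -/
  target : ℝ
  /-- sampling thresholds -/
  e : Fin K → ℝ
  /-- range of the overshoot quantizers -/
  θ : Fin K → ℝ
  /-- number of bits per message about `U^k` -/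
  rU : ℕ
  /-- range parameter of the quantizers for `V^k` -/
  φ : Fin K → ℝ
  /-- number of bits used to report `V^k` at the stopping time -/
  R : Fin K → ℕ

/-- The approximation `Ũ_t` available at the fusion center. -/
def fusedU (D : Design K) (σ : Fin K → ℝ) (H : Fin K → ℕ → ℂ) (t : ℕ) : ℝ :=
  ∑ k, recovered (localU σ H k) (D.e k) (D.θ k) D.rU t

/-- The stopping time `T̃ = min {t : Ũ_t ≥ target}`. -/
def stopTime (D : Design K) (σ : Fin K → ℝ) (H : Fin K → ℕ → ℂ) : ℕ :=
  sInf {t : ℕ | D.target ≤ fusedU D σ H t}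

/-- `V^k` at the stopping time. -/
def stoppedV (D : Design K) (σ : Fin K → ℝ) (x : ℂ) (H W : Fin K → ℕ → ℂ) (k : Fin K) : ℝ :=
  localV σ x H W k (stopTime D σ H)

/-- `Ṽ^k` at the stopping time: `V^k` quantized with `R k` bits on `[-T̃ φ_k, T̃ φ_k]`. -/
def quantV (D : Design K) (σ : Fin K → ℝ) (x : ℂ) (H W : Fin K → ℕ → ℂ) (k : Fin K) : ℝ :=
  midRiser (-(stopTime D σ H * D.φ k)) (2 * (stopTime D σ H * D.φ k)) (2 ^ D.R k)
    (stoppedV D σ x H W k)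

/-- The final estimate `x̃ = Ṽ / Ũ` of the real part of `x`. -/
def estimate (D : Design K) (σ : Fin K → ℝ) (x : ℂ) (H W : Fin K → ℕ → ℂ) : ℝ :=
  (∑ k, quantV D σ x H W k) / fusedU D σ H (stopTime D σ H)

/-- The normalized error `√(I^c_T̃) (x̃_T̃ - Re x)`. -/
def normalizedError (D : Design K) (σ : Fin K → ℝ) (x : ℂ) (H W : Fin K → ℕ → ℂ) : ℝ :=
  Real.sqrt (condFisherInfo σ H (stopTime D σ H)) * (estimate D σ x H W - x.re)

/-- The channel gains observed up to the stopping time (zero afterwards). -/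
def history (D : Design K) (σ : Fin K → ℝ) (H : Fin K → ℕ → ℂ) : Fin K → ℕ → ℂ :=
  fun k τ => if τ < stopTime D σ H then H k τ else 0

/-! ### Conditional quantities given the channel gains up to the stopping time -/

variable {Ω : Type*} [MeasurableSpace Ω]

/-- A regular conditional law, given the channel gains `h` up to the stopping time, of a real
random variable `Z`, at the outcome `ω`. -/
def condLaw (μ : Measure Ω) [IsProbabilityMeasure μ] (D : Design K) (σ : Fin K → ℝ)
    (h : Ω → Fin K → ℕ → ℂ) (Z : Ω → ℝ) (ω : Ω) : ProbabilityMeasure ℝ :=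
  ⟨condDistrib Z (fun ω' => history D σ (h ω')) μ (history D σ (h ω)), inferInstance⟩

/-- The standard normal law. -/
def stdNormal : ProbabilityMeasure ℝ := ⟨gaussianReal 0 1, inferInstance⟩

/-- Design requirement on the overshoot quantizers: every expected absolute quantization error
is less than `θ_k / 2 ^ (r_U + 1)`. -/
def OvershootQuantizersOK (μ : Measure Ω) (D : Design K) (σ : Fin K → ℝ)
    (h : Ω → Fin K → ℕ → ℂ) : Prop :=
  ∀ k, ∀ n, 1 ≤ n →
    ∫⁻ ω, ENNReal.ofReal
      |quantOvershoot (localU σ (h ω) k) (D.e k) (D.θ k) D.rU n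
        - overshoot (localU σ (h ω) k) (D.e k) n| ∂μ
      < ENNReal.ofReal (D.θ k / 2 ^ (D.rU + 1))

/-- Design requirement on the quantizers of `V^k`: almost surely the conditional expectation,
given the channel gains up to the stopping time, of the absolute quantization error is less than
`T̃ φ_k / 2 ^ R_k`. -/
def FinalQuantizersOK (μ : Measure Ω) [IsProbabilityMeasure μ] (D : Design K) (σ : Fin K → ℝ)
    (x : ℂ) (h w : Ω → Fin K → ℕ → ℂ) : Prop :=
  ∀ k, ∀ᵐ ω ∂μ,
    ∫⁻ z, ENNReal.ofReal |z|
      ∂(condLaw μ D σ h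
        (fun ω' => quantV D σ x (h ω') (w ω') k - stoppedV D σ x (h ω') (w ω') k) ω : Measure ℝ)
      < ENNReal.ofReal (stopTime D σ (h ω) * D.φ k / 2 ^ D.R k)

end LTsDMLE

end

/-!
Given the channel gains, the noise part of the fused statistic at any time is centered normal with
variance the conditional Fisher information (`map_fusedNoise`). The stopping time is a function of
the gains, which are independent of the noise, so the normalized noise at the stopping time is
standard normal and independent of the gains (`map_prodMk_eq_prod_of_indepFun`). The normalized
error differs from the normalized noise by three terms (`abs_normalizedError_sub_le`): the relative
error of the recovered information multiplied by the normalized noise, the error of the recovered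
information relative to its square root, and the quantization errors of the statistics `V^k`.
Their conditional means are shown to vanish almost surely, and weak convergence follows by testing
against bounded Lipschitz functions in the joint conditional law
(`abs_integral_condDistrib_sub_le`).

The convergence has to hold almost surely along an arbitrary sequence of targets, so the bounds on
the mean quantization errors of the overshoots, which only give convergence in mean, do not suffice
directly. They are turned into almost sure bounds by renewal theory
(`IsRenewalSequence.exists_overshoot_bound`). The mean excess of the first overshoot over `θ`
tends to zero. On the other hand, large levels carry renewal mass bounded away from zero: windows of
a fixed length do (`IsRenewalSequence.exists_window`), and mass is transported by sums of points of
the support of the step law (`IsRenewalSequence.exists_mul_renewalMeasure_le`). If the support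
generates a dense subgroup of `ℝ`, such mass is found arbitrarily close below every large level,
so a step longer than `θ` would produce an excess bounded away from zero; hence all steps are at
most `θ`. If it generates a lattice, every large lattice point carries mass, only finitely many step
sizes occur, and every possible excess is at most a constant multiple of the mean excess. In both
cases the steps are bounded, and the quantization errors of the overshoots are almost surely
`O(2 ^ (-r_U))`.

There are at most `U_t / e_k` messages up to time `t`, so the recovered information is off by
`∑ e_k` plus `O(U_t 2 ^ (-r_U) / e_k)`, which is `o(√target)` when `U_t` is of the order of the
target. Since the steps are bounded, `U_t` at the stopping time lies between half and three times
the target, for every outcome. Finally the stopping time is of the order of the target by the strong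
law of large numbers, while `2 ^ R_k` is eventually at least the square of the target, so the
quantization errors of the statistics `V^k` are negligible as well.
-/

namespace LTsDMLE

/-! ### The mid-riser quantizer on `[0, θ]` -/

theorem midRiser_le {θ : ℝ} (hθ : 0 < θ) {N : ℕ} (hN : 0 < N) (v : ℝ) :
    midRiser 0 θ N v ≤ θ - θ / (2 * N) := by
  have hN' : (0 : ℝ) < N := by exact_mod_cast hN
  have h1 : max 0 (min ((N : ℤ) - 1) ⌊(v - 0) / (θ / N)⌋) ≤ (N : ℤ) - 1 :=
    max_le (by omega) (min_le_left _ _)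
  have h2 : ((max 0 (min ((N : ℤ) - 1) ⌊(v - 0) / (θ / N)⌋) : ℤ) : ℝ) ≤ N - 1 := by
    exact_mod_cast h1
  have hc : 0 < θ / N := by positivity
  have : θ - θ / (2 * N) = ((N : ℝ) - 1 + 1 / 2) * (θ / N) := by field_simp; ring
  rw [this, midRiser, zero_add]
  gcongr

/-- For a non-negative input the error is half a cell, plus the amount by which the input
exceeds the range. -/
theorem abs_midRiser_sub_le {θ : ℝ} (hθ : 0 < θ) {N : ℕ} (hN : 0 < N) {v : ℝ} (hv : 0 ≤ v) :
    |midRiser 0 θ N v - v| ≤ θ / (2 * N) + max (v - θ) 0 := by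
  have hN' : (0 : ℝ) < N := by exact_mod_cast hN
  have hc : 0 < θ / N := by positivity
  have hθ' : θ = N * (θ / N) := by field_simp
  have hhalf : θ / (2 * N) = (θ / N) / 2 := by field_simp
  set c := θ / N with hcdef
  have hfl0 : 0 ≤ ⌊v / c⌋ := Int.floor_nonneg.2 (by positivity)
  have hfl1 : (⌊v / c⌋ : ℝ) * c ≤ v := by
    have := Int.floor_le (v / c)
    calc (⌊v / c⌋ : ℝ) * c ≤ v / c * c := by gcongr
      _ = v := by field_simp
  have hfl2 : v < ((⌊v / c⌋ : ℝ) + 1) * c := by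
    have := Int.lt_floor_add_one (v / c)
    calc v = v / c * c := by field_simp
      _ < _ := by gcongr
  rw [hhalf, midRiser, sub_zero, zero_add, ← hcdef]
  rcases le_or_gt ⌊v / c⌋ ((N : ℤ) - 1) with h | h
  · rw [min_eq_right h, max_eq_right hfl0]
    have : |((⌊v / c⌋ : ℝ) + 1 / 2) * c - v| ≤ c / 2 := by
      rw [abs_le]; constructor <;> nlinarith
    exact this.trans (le_add_of_nonneg_right (le_max_right _ _))
  · rw [min_eq_left h.le, max_eq_right (by omega)]
    have hNv : (N : ℝ) * c ≤ v := by
      refine le_trans ?_ hfl1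
      have : (N : ℤ) ≤ ⌊v / c⌋ := by omega
      have : (N : ℝ) ≤ ⌊v / c⌋ := by exact_mod_cast this
      gcongr
    rw [hθ', max_eq_left (by linarith)]
    push_cast
    rw [abs_le]; constructor <;> nlinarith

/-! ### Level-triggered sampling of an increasing path -/

section Sampling

variable {U : ℕ → ℝ} {e : ℝ}

theorem sampleTime_succ_mem (htop : Tendsto U atTop atTop) (n : ℕ) :
    sampleTime U e n < sampleTime U e (n + 1) ∧
      e ≤ U (sampleTime U e (n + 1)) - U (sampleTime U e n) := by
  have hne : {t : ℕ | sampleTime U e n < t ∧ e ≤ U t - U (sampleTime U e n)}.Nonempty := by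
    obtain ⟨t, h1, h2⟩ := ((htop.eventually_ge_atTop (e + U (sampleTime U e n))).and
      (eventually_gt_atTop (sampleTime U e n))).exists
    exact ⟨t, h2, by linarith⟩
  exact Nat.sInf_mem hne

theorem sub_lt_of_lt_sampleTime_succ (he : 0 < e) {n t : ℕ} (h1 : sampleTime U e n ≤ t)
    (h2 : t < sampleTime U e (n + 1)) : U t - U (sampleTime U e n) < e := by
  rcases h1.eq_or_lt with h | h
  · rw [← h]; simpa using he
  · by_contra hc
    push Not at hc
    exact Nat.notMem_of_lt_sInf (s := {t : ℕ | sampleTime U e n < t ∧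
      e ≤ U t - U (sampleTime U e n)}) h2 ⟨h, hc⟩

theorem strictMono_sampleTime (htop : Tendsto U atTop atTop) : StrictMono (sampleTime U e) :=
  strictMono_nat_of_lt_succ fun n => (sampleTime_succ_mem htop n).1

/-- The first sampling time is the step at which the path first reaches the level `e`. -/
theorem sampleTime_one_eq (hU0 : U 0 = 0) (hmono : Monotone U) {n : ℕ}
    (h1 : U n < e) (h2 : e ≤ U (n + 1)) : sampleTime U e 1 = n + 1 := by
  have hmem : n + 1 ∈ {t : ℕ | sampleTime U e 0 < t ∧ e ≤ U t - U (sampleTime U e 0)} := by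
    simp only [sampleTime, Set.mem_ofPred_eq]
    exact ⟨by omega, by rw [hU0]; linarith⟩
  refine le_antisymm (Nat.sInf_le hmem) (le_csInf ⟨_, hmem⟩ fun t ht => ?_)
  simp only [sampleTime, Set.mem_ofPred_eq, hU0] at ht
  by_contra hc
  have := hmono (show t ≤ n by omega)
  linarith [ht.2]

/-- The step of the path that completes the `n`-th sample starts less than `e` above the previous
sample. -/
theorem exists_overshoot_eq (htop : Tendsto U atTop atTop) (he : 0 < e)
    {n : ℕ} (hn : 1 ≤ n) :
    ∃ s τ, s ≤ τ ∧ U τ - U s < e ∧ overshoot U e n = U (τ + 1) - U s - e ∧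
      0 ≤ overshoot U e n := by
  obtain ⟨m, rfl⟩ : ∃ m, n = m + 1 := ⟨n - 1, by omega⟩
  obtain ⟨h1, h2⟩ := sampleTime_succ_mem (e := e) htop m
  obtain ⟨τ, hτ⟩ : ∃ τ, sampleTime U e (m + 1) = τ + 1 := ⟨sampleTime U e (m + 1) - 1, by omega⟩
  refine ⟨sampleTime U e m, τ, by omega,
    sub_lt_of_lt_sampleTime_succ he (by omega) (by omega), ?_, ?_⟩
  · rw [overshoot, hτ]; simp
  · rw [overshoot]; simp; linarith

theorem messageCount_spec (htop : Tendsto U atTop atTop) (t : ℕ) :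
    sampleTime U e (messageCount U e t) ≤ t ∧ t < sampleTime U e (messageCount U e t + 1) := by
  have hs := strictMono_sampleTime (U := U) (e := e) htop
  obtain ⟨m, hm1, hm2⟩ : ∃ m, sampleTime U e m ≤ t ∧ t < sampleTime U e (m + 1) := by
    have hex : ∃ n, t < sampleTime U e n := ⟨t + 1, lt_of_lt_of_le (by omega) (hs.le_apply)⟩
    classical
    refine ⟨Nat.find hex - 1, ?_, ?_⟩
    · have h0 : Nat.find hex ≠ 0 := by
        intro h
        have := Nat.find_spec hex
        rw [h, sampleTime] at this
        omega
      have := Nat.find_min hex (m := Nat.find hex - 1) (by omega)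
      omega
    · have h0 : Nat.find hex ≠ 0 := by
        intro h
        have := Nat.find_spec hex
        rw [h, sampleTime] at this
        omega
      rw [Nat.sub_add_cancel (by omega)]
      exact Nat.find_spec hex
  have : messageCount U e t = m := by
    have hfil : (Finset.Icc 1 t).filter (fun n => sampleTime U e n ≤ t) = Finset.Icc 1 m := by
      ext n
      simp only [Finset.mem_filter, Finset.mem_Icc]
      have hn : n ≤ sampleTime U e n := hs.le_apply
      constructor
      · rintro ⟨⟨h1, -⟩, h2⟩
        exact ⟨h1, Nat.lt_succ_iff.1 (hs.lt_iff_lt.1 (h2.trans_lt hm2))⟩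
      · rintro ⟨h1, h2⟩
        have := hs.monotone h2
        exact ⟨⟨h1, by omega⟩, by omega⟩
    rw [messageCount, hfil]; simp
  rw [this]; exact ⟨hm1, hm2⟩

theorem sum_overshoot (m : ℕ) :
    ∑ n ∈ Finset.Icc 1 m, (e + overshoot U e n) = U (sampleTime U e m) - U 0 := by
  induction m with
  | zero => simp [sampleTime]
  | succ m ih =>
    rw [Finset.sum_Icc_succ_top (by omega), ih, overshoot]
    simp

/-- If all quantization errors are at most `δ`, the recovered path is off by at most the threshold
plus `δ` for each of at most `U t / e` messages. -/
theorem abs_recovered_sub_le (hU0 : U 0 = 0) (hmono : Monotone U)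
    (htop : Tendsto U atTop atTop) (he : 0 < e) {θ δ : ℝ} (hδ : 0 ≤ δ) {r : ℕ}
    (hq : ∀ n, 1 ≤ n → |quantOvershoot U e θ r n - overshoot U e n| ≤ δ) (t : ℕ) :
    |recovered U e θ r t - U t| ≤ e + U t * (δ / e) := by
  obtain ⟨h1, h2⟩ := messageCount_spec (e := e) htop t
  set m := messageCount U e t
  have hlt := sub_lt_of_lt_sampleTime_succ he h1 h2
  have hle := hmono h1
  have hsum := sum_overshoot (U := U) (e := e) m
  rw [hU0, sub_zero] at hsum
  have hm : m * e ≤ U t := by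
    refine le_trans ?_ hle
    rw [← hsum]
    calc (m : ℝ) * e = ∑ n ∈ Finset.Icc 1 m, e := by simp
      _ ≤ _ := Finset.sum_le_sum fun n hn => by
        obtain ⟨_, _, _, _, _, h⟩ := exists_overshoot_eq htop he (Finset.mem_Icc.1 hn).1
        linarith
  have hdiff : |recovered U e θ r t - U (sampleTime U e m)| ≤ m * δ := by
    rw [recovered, ← hsum, ← Finset.sum_sub_distrib]
    calc _ ≤ ∑ n ∈ Finset.Icc 1 m, |(e + quantOvershoot U e θ r n) - (e + overshoot U e n)| :=
          Finset.abs_sum_le_sum_abs _ _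
      _ ≤ ∑ n ∈ Finset.Icc 1 m, δ := Finset.sum_le_sum fun n hn => by
          rw [add_sub_add_left_eq_sub]; exact hq n (Finset.mem_Icc.1 hn).1
      _ = m * δ := by simp
  have hmδ : m * δ ≤ U t * (δ / e) := by
    calc m * δ = m * e * (δ / e) := by field_simp
      _ ≤ _ := by gcongr
  rw [abs_le] at hdiff ⊢
  constructor <;> linarith [hdiff.1, hdiff.2]

end Sampling

/-! ### The renewal measure of a random walk with positive steps -/

/-- The random walk with steps `X`, started at `0`. -/
noncomputable def walk {Ω : Type*} (X : ℕ → Ω → ℝ) (n : ℕ) (ω : Ω) : ℝ :=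
  ∑ τ ∈ Finset.range n, X τ ω

/-- `X` is a sequence of i.i.d. random variables that are almost surely positive. -/
structure IsRenewalSequence {Ω : Type*} [MeasurableSpace Ω] (μ : Measure Ω) (X : ℕ → Ω → ℝ) :
    Prop where
  meas : ∀ i, Measurable (X i)
  indep : iIndepFun X μ
  ident : ∀ i, IdentDistrib (X i) (X 0) μ μ
  pos : ∀ᵐ ω ∂μ, ∀ i, 0 < X i ω

/-- The renewal measure: the expected number of visits of the walk to a set. -/
noncomputable def renewalMeasure {Ω : Type*} [MeasurableSpace Ω] (μ : Measure Ω)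
    (X : ℕ → Ω → ℝ) : Measure ℝ :=
  Measure.sum fun n => μ.map (walk X n)

theorem walk_succ {Ω : Type*} (X : ℕ → Ω → ℝ) (n : ℕ) (ω : Ω) :
    walk X (n + 1) ω = walk X n ω + X n ω := Finset.sum_range_succ _ _

section Renewal

variable {Ω : Type*} [MeasurableSpace Ω] {μ : Measure Ω} {X : ℕ → Ω → ℝ}

namespace IsRenewalSequence

theorem measurable_walk (hX : IsRenewalSequence μ X) (n : ℕ) : Measurable (walk X n) :=
  Finset.measurable_sum _ fun i _ => hX.meas i

theorem renewalMeasure_apply (hX : IsRenewalSequence μ X) {A : Set ℝ} (hA : MeasurableSet A) :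
    renewalMeasure μ X A = ∑' n, μ (walk X n ⁻¹' A) := by
  rw [renewalMeasure, Measure.sum_apply _ hA]
  exact tsum_congr fun n => Measure.map_apply (hX.measurable_walk n) hA

theorem monotone_walk (hX : IsRenewalSequence μ X) : ∀ᵐ ω ∂μ, Monotone fun n => walk X n ω := by
  filter_upwards [hX.pos] with ω h
  exact monotone_nat_of_le_succ fun n => by rw [walk_succ]; linarith [h n]

/-- The step taken from a visited point is independent of that point, so the expected number of
visits to `A` followed by a step in `J` is a product. -/
theorem tsum_visit_step (hX : IsRenewalSequence μ X) {A J : Set ℝ} (hA : MeasurableSet A)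
    (hJ : MeasurableSet J) :
    ∑' n, μ (walk X n ⁻¹' A ∩ X n ⁻¹' J) = renewalMeasure μ X A * μ.map (X 0) J := by
  rw [hX.renewalMeasure_apply hA, ← ENNReal.tsum_mul_right]
  refine tsum_congr fun n => ?_
  have hind : IndepFun (walk X n) (X n) μ := by
    have := hX.indep.indepFun_sum_range_succ hX.meas n
    convert! this using 1
    ext ω; simp [walk]
  rw [hind.measure_inter_preimage_eq_mul _ _ hA hJ, ← (hX.ident n).map_eq,
    Measure.map_apply (hX.meas n) hJ]

/-- If the events `walk n ∈ A`, `X n ∈ J` for different `n` exclude each other, the expected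
number of their occurrences is the probability of their union. -/
theorem measure_iUnion_visit_step (hX : IsRenewalSequence μ X) {A J : Set ℝ} {c : ℝ}
    (hA : MeasurableSet A) (hJ : MeasurableSet J)
    (hAJ : ∀ z ∈ A, ∀ y ∈ J, c ≤ z + y) (hAc : ∀ z ∈ A, z < c) :
    μ (⋃ n, walk X n ⁻¹' A ∩ X n ⁻¹' J) = renewalMeasure μ X A * μ.map (X 0) J := by
  rw [← hX.tsum_visit_step hA hJ]
  refine measure_iUnion₀ ?_ fun n =>
    ((hX.measurable_walk n hA).inter (hX.meas n hJ)).nullMeasurableSet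
  have key : ∀ m n, m < n →
      AEDisjoint μ (walk X m ⁻¹' A ∩ X m ⁻¹' J) (walk X n ⁻¹' A ∩ X n ⁻¹' J) := by
    intro m n hmn
    refine measure_mono_null ?_ (ae_iff.1 hX.monotone_walk)
    rintro ω ⟨⟨h1, h2⟩, ⟨h3, -⟩⟩ hmono
    have h4 := hmono (show m + 1 ≤ n from hmn)
    simp only [walk_succ] at h4
    linarith [hAJ _ h1 _ h2, hAc _ h3]
  intro m n hmn
  rcases lt_or_gt_of_ne hmn with h | h
  · exact key m n h
  · exact (key n m h).symm

theorem renewalMeasure_Ico_mul_le [IsProbabilityMeasure μ] (hX : IsRenewalSequence μ X)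
    (u c : ℝ) : renewalMeasure μ X (Set.Ico u (u + c)) * μ.map (X 0) (Set.Ici c) ≤ 1 := by
  rw [← hX.measure_iUnion_visit_step (c := u + c) measurableSet_Ico measurableSet_Ici
    (fun z hz y hy => add_le_add hz.1 hy) (fun z hz => hz.2)]
  exact prob_le_one

theorem exists_pos_measure_Ici [IsProbabilityMeasure μ] (hX : IsRenewalSequence μ X) :
    ∃ c, 0 < c ∧ μ.map (X 0) (Set.Ici c) ≠ 0 := by
  by_contra! hc
  have h0 : μ.map (X 0) (Set.Ioi 0) = 0 := by
    have : Set.Ioi (0 : ℝ) ⊆ ⋃ n : ℕ, Set.Ici (1 / ((n : ℝ) + 1)) := by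
      intro x hx
      obtain ⟨n, hn⟩ := exists_nat_one_div_lt (Set.mem_Ioi.1 hx)
      exact Set.mem_iUnion.2 ⟨n, hn.le⟩
    exact measure_mono_null this (measure_iUnion_null fun n => hc _ (by positivity))
  rw [Measure.map_apply (hX.meas 0) measurableSet_Ioi] at h0
  have h1 : μ (X 0 ⁻¹' Set.Ioi 0) = 1 := by
    rw [← mem_ae_iff_prob_eq_one (hX.meas 0 measurableSet_Ioi)]
    filter_upwards [hX.pos] with ω h using h 0
  rw [h1] at h0
  exact one_ne_zero h0

theorem ae_tendsto_walk_div (hX : IsRenewalSequence μ X) (hint : Integrable (X 0) μ) :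
    ∀ᵐ ω ∂μ, Tendsto (fun n : ℕ => walk X n ω / n) atTop (𝓝 (∫ ω, X 0 ω ∂μ)) :=
  strong_law_ae_real X hint (fun _ _ h => hX.indep.indepFun h) hX.ident

theorem integral_pos [IsProbabilityMeasure μ] (hX : IsRenewalSequence μ X)
    (hint : Integrable (X 0) μ) : 0 < ∫ ω, X 0 ω ∂μ := by
  have hpos : ∀ᵐ ω ∂μ, 0 < X 0 ω := by filter_upwards [hX.pos] with ω h using h 0
  rw [integral_pos_iff_support_of_nonneg_ae (hpos.mono fun _ h => h.le) hint]
  have : (Function.support (X 0)) =ᵐ[μ] Set.univ := by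
    filter_upwards [hpos] with ω h
    exact propext ⟨fun _ => trivial, fun _ => h.ne'⟩
  rw [measure_congr this]; simp

theorem ae_tendsto_walk_atTop [IsProbabilityMeasure μ] (hX : IsRenewalSequence μ X)
    (hint : Integrable (X 0) μ) : ∀ᵐ ω ∂μ, Tendsto (fun n => walk X n ω) atTop atTop := by
  filter_upwards [hX.ae_tendsto_walk_div hint] with ω h
  have h2 := h.pos_mul_atTop (hX.integral_pos hint) tendsto_natCast_atTop_atTop
  refine h2.congr' ?_
  filter_upwards [eventually_gt_atTop 0] with n hn
  have : (n : ℝ) ≠ 0 := by positivity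
  field_simp

/-- With integrable steps, a window of some fixed length carries renewal mass at least one half,
wherever it lies. The level `t` is crossed by exactly one step; a crossing step that starts far
below `t` is long, and unit cells carry bounded mass, so such crossings are rare. -/
theorem exists_window [IsProbabilityMeasure μ] (hX : IsRenewalSequence μ X)
    (hint : Integrable (X 0) μ) :
    ∃ B, 0 < B ∧ ∀ t, 0 < t → 2⁻¹ ≤ renewalMeasure μ X (Set.Ico (t - B) t) := by
  obtain ⟨c, hc, hρ⟩ := hX.exists_pos_measure_Ici
  set ρ := μ.map (X 0) (Set.Ici c) with hρdef
  have hρtop : ρ ≠ ⊤ := by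
    have : IsProbabilityMeasure (μ.map (X 0)) :=
      Measure.isProbabilityMeasure_map (hX.meas 0).aemeasurable
    exact measure_ne_top _ _
  set f : ℕ → ℝ≥0∞ := fun i => μ.map (X 0) (Set.Ioi (i * c)) with hf
  have hsum : ∑' i, f i ≠ ⊤ := by
    let _ : MeasureSpace Ω := ⟨μ⟩
    have h1 : Integrable (fun ω => max (X 0 ω) 0 / c) μ := (hint.pos_part).div_const c
    have h2 := tsum_prob_mem_Ioi_lt_top (Ω := Ω) h1 (fun ω => by
      simp only [Pi.zero_apply]; positivity)
    refine ne_of_lt (lt_of_le_of_lt (ENNReal.tsum_le_tsum fun i => ?_) h2)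
    rw [hf]
    simp only
    rw [Measure.map_apply (hX.meas 0) measurableSet_Ioi]
    refine measure_mono fun ω hω => ?_
    simp only [Set.mem_preimage, Set.mem_Ioi] at hω
    have : (i : ℝ) < max (X 0 ω) 0 / c := by
      rw [lt_div_iff₀ hc]; exact lt_max_of_lt_left hω
    exact this
  obtain ⟨i₀, hi₀, hi₀'⟩ : ∃ i₀, ∑' i, f (i + i₀) ≤ ρ / 2 ∧ 1 ≤ i₀ :=
    (((ENNReal.tendsto_sum_nat_add f hsum).eventually_le_const
      (ENNReal.half_pos hρ)).and (eventually_ge_atTop 1)).exists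
  have hi₀r : (1 : ℝ) ≤ i₀ := by exact_mod_cast hi₀'
  refine ⟨i₀ * c, by positivity, fun t ht => ?_⟩
  set E : ℕ → Set Ω := fun n => {ω | walk X n ω < t ∧ t ≤ walk X n ω + X n ω}
  set F : ℕ → ℕ → Set Ω := fun i n =>
    walk X n ⁻¹' Set.Ico (t - ((i + i₀ : ℕ) : ℝ) * c - c) (t - ((i + i₀ : ℕ) : ℝ) * c - c + c) ∩
      X n ⁻¹' Set.Ioi (((i + i₀ : ℕ) : ℝ) * c)
  have hEF : ∀ n, E n ⊆ walk X n ⁻¹' Set.Ico (t - i₀ * c) t ∪ ⋃ i, F i n := by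
    rintro n ω ⟨h1, h2⟩
    rcases le_or_gt (t - i₀ * c) (walk X n ω) with h | h
    · exact Or.inl ⟨h, h1⟩
    · right
      have hx : (i₀ : ℝ) < (t - walk X n ω) / c := by rw [lt_div_iff₀ hc]; linarith
      have hx1 : i₀ < ⌈(t - walk X n ω) / c⌉₊ := Nat.lt_ceil.2 hx
      obtain ⟨i, hi⟩ : ∃ i, ⌈(t - walk X n ω) / c⌉₊ = i + i₀ + 1 :=
        ⟨⌈(t - walk X n ω) / c⌉₊ - i₀ - 1, by omega⟩
      have h3 := Nat.le_ceil ((t - walk X n ω) / c)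
      have h4 := Nat.ceil_lt_add_one (a := (t - walk X n ω) / c) (by
        have : (0 : ℝ) ≤ i₀ := by positivity
        linarith)
      rw [hi, Nat.cast_add_one] at h3 h4
      rw [div_le_iff₀ hc] at h3
      have h5 : ((i + i₀ : ℕ) : ℝ) * c < t - walk X n ω := by
        rw [← lt_div_iff₀ hc]; linarith
      refine Set.mem_iUnion.2 ⟨i, ⟨⟨?_, ?_⟩, ?_⟩⟩
      · linarith
      · linarith
      · simp only [Set.mem_preimage, Set.mem_Ioi]; linarith
  have hcover : (1 : ℝ≥0∞) ≤ ∑' n, μ (E n) := by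
    have : μ (⋃ n, E n) = 1 := by
      rw [← measure_univ (μ := μ)]
      refine measure_congr ?_
      filter_upwards [hX.ae_tendsto_walk_atTop hint] with ω hω
      refine propext ⟨fun _ => trivial, fun _ => ?_⟩
      have hex : ∃ n, t ≤ walk X n ω := (hω.eventually_ge_atTop t).exists
      classical
      have h0 : Nat.find hex ≠ 0 := by
        intro h
        have := Nat.find_spec hex
        rw [h] at this
        simp only [walk, Finset.range_zero, Finset.sum_empty] at this
        linarith
      have h1 := Nat.find_min hex (m := Nat.find hex - 1) (by omega)
      have h2 := Nat.find_spec hex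
      refine Set.mem_iUnion.2 ⟨Nat.find hex - 1, not_le.1 h1, ?_⟩
      rwa [← walk_succ, Nat.sub_add_cancel (by omega)]
    rw [← this]
    exact measure_iUnion_le _
  have hF : ∀ i, ∑' n, μ (F i n) ≤ ρ⁻¹ * f (i + i₀) := by
    intro i
    rw [hX.tsum_visit_step measurableSet_Ico measurableSet_Ioi]
    gcongr
    rw [ENNReal.le_inv_iff_mul_le]
    exact hX.renewalMeasure_Ico_mul_le _ _
  have hfinal : (1 : ℝ≥0∞) ≤ renewalMeasure μ X (Set.Ico (t - i₀ * c) t) + 2⁻¹ := by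
    calc (1 : ℝ≥0∞) ≤ ∑' n, μ (E n) := hcover
      _ ≤ ∑' n, (μ (walk X n ⁻¹' Set.Ico (t - i₀ * c) t) + ∑' i, μ (F i n)) :=
        ENNReal.tsum_le_tsum fun n => (measure_mono (hEF n)).trans
          ((measure_union_le _ _).trans (add_le_add le_rfl (measure_iUnion_le _)))
      _ = renewalMeasure μ X (Set.Ico (t - i₀ * c) t) + ∑' i, ∑' n, μ (F i n) := by
        rw [ENNReal.tsum_add, hX.renewalMeasure_apply measurableSet_Ico, ENNReal.tsum_comm]
      _ ≤ renewalMeasure μ X (Set.Ico (t - i₀ * c) t) + ∑' i, ρ⁻¹ * f (i + i₀) := by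
        gcongr with i; exact hF i
      _ ≤ _ := by
        rw [ENNReal.tsum_mul_left]
        gcongr
        calc ρ⁻¹ * ∑' i, f (i + i₀) ≤ ρ⁻¹ * (ρ / 2) := by gcongr
          _ = 2⁻¹ := by
            rw [div_eq_mul_inv, ← mul_assoc, ENNReal.inv_mul_cancel hρ hρtop, one_mul]
  calc (2⁻¹ : ℝ≥0∞) = 1 - 2⁻¹ := ENNReal.one_sub_inv_two.symm
    _ ≤ _ := tsub_le_iff_right.2 hfinal

/-- Renewal mass propagates: from a set to its translate by any sum of points of the support of
the step law, up to an arbitrarily small enlargement. -/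
theorem exists_mul_renewalMeasure_le [IsProbabilityMeasure μ] (hX : IsRenewalSequence μ X)
    {s : ℝ} (hs : s ∈ AddSubmonoid.closure (μ.map (X 0)).support) :
    ∀ ε, 0 < ε → ∃ q : ℝ≥0∞, q ≠ 0 ∧ q ≠ ⊤ ∧ ∀ A, MeasurableSet A →
      q * renewalMeasure μ X A ≤ renewalMeasure μ X {y | ∃ z ∈ A, |y - z - s| < ε} := by
  have hprob : IsProbabilityMeasure (μ.map (X 0)) :=
    Measure.isProbabilityMeasure_map (hX.meas 0).aemeasurable
  have hmeas : ∀ (A : Set ℝ) (s ε : ℝ), MeasurableSet {y | ∃ z ∈ A, |y - z - s| < ε} := by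
    intro A s ε
    have : {y | ∃ z ∈ A, |y - z - s| < ε} = ⋃ z ∈ A, Metric.ball (z + s) ε := by
      ext y
      simp [Real.dist_eq, sub_sub]
    rw [this]
    exact (isOpen_biUnion fun _ _ => Metric.isOpen_ball).measurableSet
  induction hs using AddSubmonoid.closure_induction with
  | mem s hs =>
    intro ε hε
    refine ⟨μ.map (X 0) (Metric.ball s ε), ?_, measure_ne_top _ _, fun A hA => ?_⟩
    · exact (((μ.map (X 0)).mem_support_iff_forall s).1 hs _ (Metric.ball_mem_nhds s hε)).ne'
    · rw [mul_comm, ← hX.tsum_visit_step hA measurableSet_ball,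
        hX.renewalMeasure_apply (hmeas A s ε)]
      refine le_trans (ENNReal.tsum_le_tsum fun n => measure_mono ?_)
        (ENNReal.tsum_comp_le_tsum_of_injective (add_left_injective 1)
          fun n => μ (walk X n ⁻¹' {y | ∃ z ∈ A, |y - z - s| < ε}))
      rintro ω ⟨h1, h2⟩
      refine ⟨walk X n ω, h1, ?_⟩
      rw [walk_succ, add_sub_cancel_left]
      simpa [Real.dist_eq] using h2
  | zero =>
    intro ε hε
    refine ⟨1, one_ne_zero, ENNReal.one_ne_top, fun A _ => ?_⟩
    rw [one_mul]
    exact measure_mono fun z hz => ⟨z, hz, by simpa using hε⟩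
  | add s s' _ _ ih ih' =>
    intro ε hε
    obtain ⟨q, h1, h2, h3⟩ := ih (ε / 2) (by positivity)
    obtain ⟨q', h1', h2', h3'⟩ := ih' (ε / 2) (by positivity)
    refine ⟨q' * q, mul_ne_zero h1' h1, ENNReal.mul_ne_top h2' h2, fun A hA => ?_⟩
    calc q' * q * renewalMeasure μ X A = q' * (q * renewalMeasure μ X A) := mul_assoc _ _ _
      _ ≤ q' * renewalMeasure μ X {y | ∃ z ∈ A, |y - z - s| < ε / 2} := by
        gcongr; exact h3 A hA
      _ ≤ _ := h3' _ (hmeas _ _ _)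
      _ ≤ _ := by
        refine measure_mono ?_
        rintro y ⟨z', ⟨z, hz, hz1⟩, hz2⟩
        refine ⟨z, hz, ?_⟩
        calc |y - z - (s + s')| = |(y - z' - s') + (z' - z - s)| := by congr 1; ring
          _ ≤ _ := abs_add_le _ _
          _ < ε := by linarith

end IsRenewalSequence
end Renewal

/-- A submonoid of `ℝ` containing `b > 0` and `b + δ` eventually has a point in every half-open
interval of length `δ`. -/
theorem exists_forall_ge_mem_Ioc {P : AddSubmonoid ℝ} {b δ : ℝ} (hb : b ∈ P) (hbδ : b + δ ∈ P)
    (hb0 : 0 < b) (hδ : 0 < δ) : ∃ A, 0 < A ∧ ∀ s, A ≤ s → ∃ s' ∈ P, s - δ < s' ∧ s' ≤ s := by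
  obtain ⟨n₀, hn₀⟩ := exists_nat_ge (b / δ)
  have hn0 : (0 : ℝ) < n₀ := lt_of_lt_of_le (by positivity) hn₀
  refine ⟨n₀ * b, by positivity, fun s hs => ?_⟩
  have hs0 : 0 ≤ s := le_trans (by positivity) hs
  set n := ⌊s / b⌋₊
  have h1 : (n : ℝ) * b ≤ s := by
    rw [← le_div_iff₀ hb0]; exact Nat.floor_le (by positivity)
  have h2 : s < ((n : ℝ) + 1) * b := by
    rw [← div_lt_iff₀ hb0]; exact Nat.lt_floor_add_one _
  have h3 : n₀ ≤ n := Nat.le_floor (by rwa [le_div_iff₀ hb0])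
  set i := ⌊(s - n * b) / δ⌋₊
  have h4 : (i : ℝ) * δ ≤ s - n * b := by
    rw [← le_div_iff₀ hδ]; exact Nat.floor_le (div_nonneg (by linarith) hδ.le)
  have h5 : s - n * b < ((i : ℝ) + 1) * δ := by
    rw [← div_lt_iff₀ hδ]; exact Nat.lt_floor_add_one _
  have h6 : i ≤ n := by
    have : (i : ℝ) ≤ n := by
      calc (i : ℝ) ≤ (s - n * b) / δ := by rwa [le_div_iff₀ hδ]
        _ ≤ b / δ := by gcongr; linarith
        _ ≤ n₀ := hn₀
        _ ≤ n := by exact_mod_cast h3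
    exact_mod_cast this
  refine ⟨(n - i) • b + i • (b + δ), P.add_mem (P.nsmul_mem hb _) (P.nsmul_mem hbδ _), ?_, ?_⟩ <;>
  · simp only [nsmul_eq_mul, Nat.cast_sub h6]
    nlinarith

/-! ### Lower bounds for the renewal measure and boundedness of the overshoots -/

/-- If finitely many masses sum to at least one half and each, scaled by a fixed positive factor,
is at most `y`, then `y` is at least a positive constant. -/
theorem exists_le_of_half_le_sum (m : ℕ) (q : ℕ → ℝ≥0∞) (hq : ∀ i, q i ≠ 0)
    (hq' : ∀ i, q i ≠ ⊤) :
    ∃ c : ℝ≥0∞, c ≠ 0 ∧ c ≠ ⊤ ∧ ∀ (x : ℕ → ℝ≥0∞) (y : ℝ≥0∞), 2⁻¹ ≤ ∑ i ∈ Finset.range m, x i →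
      (∀ i, q i * x i ≤ y) → c ≤ y := by
  refine ⟨min 1 (2⁻¹ / ∑ i ∈ Finset.range m, (q i)⁻¹), ?_,
    ne_top_of_le_ne_top ENNReal.one_ne_top (min_le_left _ _), fun x y hx hy => ?_⟩
  · refine (lt_min one_pos ?_).ne'
    refine ENNReal.div_pos (by simp) ?_
    exact ENNReal.sum_ne_top.2 fun i _ => ENNReal.inv_ne_top.2 (hq i)
  · refine (min_le_right _ _).trans (ENNReal.div_le_of_le_mul' (hx.trans ?_))
    rw [Finset.sum_mul]
    refine Finset.sum_le_sum fun i _ => ?_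
    rw [← ENNReal.div_eq_inv_mul, ENNReal.le_div_iff_mul_le (Or.inl (hq i)) (Or.inl (hq' i)),
      mul_comm]
    exact hy i

/-- Elements of the subgroup generated by a set are differences of elements of the submonoid it
generates. -/
theorem exists_sub_of_mem_addSubgroupClosure {s : Set ℝ} {x : ℝ}
    (hx : x ∈ AddSubgroup.closure s) :
    ∃ a ∈ AddSubmonoid.closure s, ∃ b ∈ AddSubmonoid.closure s, x = a - b := by
  induction hx using AddSubgroup.closure_induction with
  | mem x hx => exact ⟨x, AddSubmonoid.subset_closure hx, 0, zero_mem _, by simp⟩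
  | zero => exact ⟨0, zero_mem _, 0, zero_mem _, by simp⟩
  | add x y _ _ ihx ihy =>
    obtain ⟨a, ha, b, hb, rfl⟩ := ihx
    obtain ⟨a', ha', b', hb', rfl⟩ := ihy
    exact ⟨a + a', add_mem ha ha', b + b', add_mem hb hb', by ring⟩
  | neg x _ ih =>
    obtain ⟨a, ha, b, hb, rfl⟩ := ih
    exact ⟨b, hb, a, ha, by ring⟩

theorem measure_le_of_ae_imp {α : Type*} [MeasurableSpace α] {ν : Measure α} {s t : Set α}
    (h : ∀ᵐ y ∂ν, y ∈ s → y ∈ t) : ν s ≤ ν t :=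
  measure_mono_ae h

namespace IsRenewalSequence

variable {Ω : Type*} [MeasurableSpace Ω] {μ : Measure Ω}
  {X : ℕ → Ω → ℝ}

theorem ae_forall_mem (hX : IsRenewalSequence μ X) {A : Set ℝ} (hA : MeasurableSet A)
    (h : μ.map (X 0) Aᶜ = 0) : ∀ᵐ ω ∂μ, ∀ i, X i ω ∈ A := by
  refine ae_all_iff.2 fun i => ?_
  rw [← (hX.ident i).map_eq, Measure.map_apply (hX.meas i) hA.compl] at h
  exact h

theorem exists_pos_mem_support [IsProbabilityMeasure μ] (hX : IsRenewalSequence μ X) :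
    ∃ x, 0 < x ∧ x ∈ (μ.map (X 0)).support := by
  obtain ⟨c, hc, h⟩ := hX.exists_pos_measure_Ici
  obtain ⟨x, hx, hx'⟩ := Measure.nonempty_inter_support_of_pos (pos_iff_ne_zero.2 h)
  exact ⟨x, hc.trans_le hx, hx'⟩

/-- An element of the group generated by the support of the step law is a difference of
two positive sums of support points. -/
theorem exists_add_mem [IsProbabilityMeasure μ] (hX : IsRenewalSequence μ X) {δ : ℝ}
    (hδ : δ ∈ AddSubgroup.closure (μ.map (X 0)).support) :
    ∃ b, 0 < b ∧ b ∈ AddSubmonoid.closure (μ.map (X 0)).support ∧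
      b + δ ∈ AddSubmonoid.closure (μ.map (X 0)).support := by
  obtain ⟨x, hx0, hx⟩ := hX.exists_pos_mem_support
  have hx' := AddSubmonoid.subset_closure hx
  obtain ⟨a, ha, b, hb, hab⟩ := exists_sub_of_mem_addSubgroupClosure hδ
  obtain ⟨n, hn⟩ := exists_nat_gt (-b / x)
  refine ⟨b + n • x, ?_, add_mem hb (nsmul_mem hx' n), ?_⟩
  · rw [div_lt_iff₀ hx0] at hn
    rw [nsmul_eq_mul]; linarith
  · rw [show b + n • x + δ = a + n • x by rw [hab]; ring]
    exact add_mem ha (nsmul_mem hx' n)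

/-- Renewal mass near every large level, at the resolution of an element of the group generated by
the support of the step law. -/
theorem exists_le_renewalMeasure_Ioo [IsProbabilityMeasure μ] (hX : IsRenewalSequence μ X)
    (hint : Integrable (X 0) μ)
    {δ : ℝ} (hδ : δ ∈ AddSubgroup.closure (μ.map (X 0)).support) (hδ0 : 0 < δ) :
    ∃ c : ℝ≥0∞, c ≠ 0 ∧ c ≠ ⊤ ∧ ∃ e₀, ∀ e, e₀ ≤ e →
      c ≤ renewalMeasure μ X (Set.Ioo (e - 3 * δ) e) := by
  obtain ⟨b, hb0, hb, hbδ⟩ := hX.exists_add_mem hδ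
  obtain ⟨B, hB0, hB⟩ := hX.exists_window hint
  obtain ⟨A, hA0, hA⟩ := exists_forall_ge_mem_Ioc hb hbδ hb0 hδ0
  obtain ⟨m, hm⟩ := exists_nat_ge (B / δ)
  rw [div_le_iff₀ hδ0] at hm
  choose s' hs'P hs'1 hs'2 using fun i : ℕ => hA (A + ((i : ℝ) + 1) * δ + δ / 2) (by
    have : 0 ≤ ((i : ℝ) + 1) * δ := by positivity
    linarith)
  choose q hq0 hq1 hq using fun i =>
    hX.exists_mul_renewalMeasure_le (hs'P i) (δ / 2) (by positivity)
  obtain ⟨c, hc0, hc1, hc⟩ := exists_le_of_half_le_sum m q hq0 hq1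
  refine ⟨c, hc0, hc1, A + 2 * δ + 1, fun e he => ?_⟩
  set t := e - A - 2 * δ with ht
  refine hc (fun i => renewalMeasure μ X (Set.Ico (t - (i + 1) * δ) (t - i * δ))) _ ?_ ?_
  · refine (hB t (by linarith)).trans ((measure_mono ?_).trans
      (measure_biUnion_finset_le (Finset.range m) _))
    rintro z ⟨hz1, hz2⟩
    have hpos : 0 < (t - z) / δ := div_pos (by linarith) hδ0
    have h1 := Nat.le_ceil ((t - z) / δ)
    have h2 := Nat.ceil_lt_add_one hpos.le
    have h0 : 0 < ⌈(t - z) / δ⌉₊ := Nat.ceil_pos.2 hpos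
    obtain ⟨i, hi⟩ : ∃ i, ⌈(t - z) / δ⌉₊ = i + 1 := ⟨⌈(t - z) / δ⌉₊ - 1, by omega⟩
    rw [hi, Nat.cast_add_one] at h1 h2
    rw [div_le_iff₀ hδ0] at h1
    have h3 : (i : ℝ) * δ < t - z := by rw [← lt_div_iff₀ hδ0]; linarith
    have him : i < m := by
      have : (i : ℝ) < m := by
        by_contra hcon
        push Not at hcon
        have : (m : ℝ) * δ ≤ i * δ := by gcongr
        linarith
      exact_mod_cast this
    simp only [Set.mem_iUnion, Finset.mem_range]
    exact ⟨i, him, by linarith, by linarith⟩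
  · intro i
    refine (hq i _ measurableSet_Ico).trans (measure_mono ?_)
    rintro y ⟨z, ⟨hz1, hz2⟩, hz3⟩
    have h1 := hs'1 i
    have h2 := hs'2 i
    rw [abs_lt] at hz3
    constructor <;> linarith [hz3.1, hz3.2]

/-- If the steps take values in `d ℤ`, so does the walk. -/
theorem ae_renewalMeasure_mem (hX : IsRenewalSequence μ X) {d : ℝ}
    (hd : (μ.map (X 0)).support ⊆ AddSubgroup.zmultiples d) :
    ∀ᵐ y ∂(renewalMeasure μ X), y ∈ AddSubgroup.zmultiples d := by
  have hZ : MeasurableSet (AddSubgroup.zmultiples d : Set ℝ) :=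
    (Set.countable_range fun z : ℤ => z • d).measurableSet
  have h0 : μ.map (X 0) (AddSubgroup.zmultiples d : Set ℝ)ᶜ = 0 :=
    measure_mono_null (Set.compl_subset_compl.2 hd) Measure.measure_compl_support
  have h1 := hX.ae_forall_mem hZ h0
  change renewalMeasure μ X (AddSubgroup.zmultiples d : Set ℝ)ᶜ = 0
  rw [hX.renewalMeasure_apply hZ.compl, ENNReal.tsum_eq_zero]
  intro n
  refine measure_mono_null ?_ (ae_iff.1 h1)
  intro ω hω hall
  exact hω (sum_mem fun i _ => hall i)

/-- In the lattice case every large lattice point carries renewal mass bounded below. -/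
theorem exists_le_renewalMeasure_singleton [IsProbabilityMeasure μ] (hX : IsRenewalSequence μ X)
    (hint : Integrable (X 0) μ) {d : ℝ} (hd0 : 0 < d)
    (hd : AddSubgroup.closure (μ.map (X 0)).support = AddSubgroup.zmultiples d) :
    ∃ c : ℝ≥0∞, c ≠ 0 ∧ c ≠ ⊤ ∧ ∃ n₀ : ℤ, ∀ n : ℤ, n₀ ≤ n →
      c ≤ renewalMeasure μ X {(n : ℝ) * d} := by
  obtain ⟨b, hb0, hb, hbδ⟩ := hX.exists_add_mem (δ := d)
    (hd ▸ AddSubgroup.mem_zmultiples d)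
  obtain ⟨B, hB0, hB⟩ := hX.exists_window hint
  obtain ⟨A, hA0, hA⟩ := exists_forall_ge_mem_Ioc hb hbδ hb0 hd0
  have hlat := hX.ae_renewalMeasure_mem (d := d) (hd ▸ AddSubgroup.subset_closure)
  have hPZ : ∀ s ∈ AddSubmonoid.closure (μ.map (X 0)).support, ∃ z : ℤ, (z : ℝ) * d = s := by
    intro s hs
    have : s ∈ AddSubgroup.closure (μ.map (X 0)).support :=
      (AddSubmonoid.closure_le (S := (AddSubgroup.closure _).toAddSubmonoid)).2
        AddSubgroup.subset_closure hs
    rw [hd, AddSubgroup.mem_zmultiples_iff] at this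
    simpa using this
  have hmul : ∀ k : ℤ, A ≤ k * d → (k : ℝ) * d ∈ AddSubmonoid.closure (μ.map (X 0)).support := by
    intro k hk
    obtain ⟨s', hs', h1, h2⟩ := hA _ hk
    obtain ⟨z, rfl⟩ := hPZ s' hs'
    have h3 : z ≤ k := by
      have : (z : ℝ) ≤ k := le_of_mul_le_mul_right h2 hd0
      exact_mod_cast this
    have h4 : k < z + 1 := by
      have : (k : ℝ) < z + 1 := lt_of_mul_lt_mul_right (by linarith) hd0.le
      exact_mod_cast this
    rwa [show k = z by omega]
  obtain ⟨k₀, hk₀⟩ := exists_nat_ge (A / d)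
  rw [div_le_iff₀ hd0] at hk₀
  obtain ⟨m, hm⟩ := exists_nat_ge (B / d)
  rw [div_le_iff₀ hd0] at hm
  choose q hq0 hq1 hq using fun i : ℕ =>
    hX.exists_mul_renewalMeasure_le (hmul (k₀ + i) (by
      push_cast
      have : 0 ≤ (i : ℝ) * d := by positivity
      linarith)) d hd0
  obtain ⟨c, hc0, hc1, hc⟩ := exists_le_of_half_le_sum m q hq0 hq1
  refine ⟨c, hc0, hc1, k₀, fun n hn => ?_⟩
  have hn' : (k₀ : ℝ) ≤ n := by exact_mod_cast hn
  refine hc (fun i => renewalMeasure μ X {((n - k₀ - i : ℤ) : ℝ) * d}) _ ?_ ?_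
  · refine (hB ((n - k₀ + 1) * d) (by apply mul_pos _ hd0; linarith)).trans
      ((measure_le_of_ae_imp ?_).trans (measure_biUnion_finset_le (Finset.range m) _))
    filter_upwards [hlat] with y hy hyI
    obtain ⟨hy1, hy2⟩ := hyI
    obtain ⟨z, rfl⟩ := AddSubgroup.mem_zmultiples_iff.1 hy
    rw [zsmul_eq_mul] at hy1 hy2
    have h1 : z < n - k₀ + 1 := by
      have : (z : ℝ) < n - k₀ + 1 := lt_of_mul_lt_mul_right hy2 hd0.le
      exact_mod_cast this
    have h2 : n - k₀ + 1 ≤ m + z := by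
      have : (n : ℝ) - k₀ + 1 ≤ m + z := le_of_mul_le_mul_right (a := d) (by linarith) hd0
      exact_mod_cast this
    simp only [Set.mem_iUnion, Finset.mem_range]
    refine ⟨(n - k₀ - z).toNat, by omega, ?_⟩
    rw [Set.mem_singleton_iff, zsmul_eq_mul]
    congr 2
    omega
  · intro i
    refine (hq i _ (measurableSet_singleton _)).trans (measure_le_of_ae_imp ?_)
    filter_upwards [hlat] with y hy hyI
    obtain ⟨z, rfl⟩ := AddSubgroup.mem_zmultiples_iff.1 hy
    obtain ⟨w, hw, hwy⟩ := hyI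
    rw [Set.mem_singleton_iff] at hw
    subst hw
    rw [Set.mem_singleton_iff, zsmul_eq_mul]
    rw [zsmul_eq_mul] at hwy
    have h1 : |((z - n : ℤ) : ℝ)| * d < 1 * d := by
      rw [← abs_of_pos hd0, ← abs_mul, abs_of_pos hd0, one_mul]
      convert! hwy using 2
      push_cast; ring
    have h2 : |z - n| < 1 := by exact_mod_cast lt_of_mul_lt_mul_right h1 hd0.le
    rw [Int.abs_lt_one_iff] at h2
    rw [show z = n by omega]

/-- A visit just below the level `e` followed by a long step gives a long first overshoot. -/
theorem renewalMeasure_mul_le_lintegral (hX : IsRenewalSequence μ X) {e θ v : ℝ} (hθ : 0 ≤ θ)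
    (hv : 0 < v) {A J : Set ℝ} (hA : MeasurableSet A) (hJ : MeasurableSet J)
    (hAe : ∀ z ∈ A, z < e) (hAJ : ∀ z ∈ A, ∀ y ∈ J, e + θ + v ≤ z + y) :
    renewalMeasure μ X A * μ.map (X 0) J * ENNReal.ofReal v ≤
      ∫⁻ ω, ENNReal.ofReal (overshoot (fun n => walk X n ω) e 1 - θ) ∂μ := by
  rw [← hX.measure_iUnion_visit_step hA hJ
    (fun z hz y hy => by linarith [hAJ z hz y hy]) hAe, mul_comm,
    ← lintegral_indicator_const
      (MeasurableSet.iUnion fun n => (hX.measurable_walk n hA).inter (hX.meas n hJ))]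
  refine lintegral_mono_ae ?_
  filter_upwards [hX.monotone_walk] with ω hmono
  refine Set.indicator_le_indicator' (g := fun ω => ENNReal.ofReal
    (overshoot (fun n => walk X n ω) e 1 - θ)) (fun hω => ?_) |>.trans
    (Set.indicator_le_self' (fun _ _ => zero_le) ω)
  obtain ⟨n, h1, h2⟩ := Set.mem_iUnion.1 hω
  have h3 := hAJ _ h1 _ h2
  rw [← walk_succ] at h3
  refine ENNReal.ofReal_le_ofReal ?_
  rw [overshoot, sampleTime_one_eq (n := n) (by simp [walk]) hmono (hAe _ h1) (by linarith)]
  simp only [sampleTime, Nat.sub_self]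
  simp only [show walk X 0 ω = 0 by simp [walk]]
  linarith

end IsRenewalSequence

namespace IsRenewalSequence

variable {Ω : Type*} [MeasurableSpace Ω] {μ : Measure Ω} {X : ℕ → Ω → ℝ}

/-- Uniform form of `renewalMeasure_mul_le_lintegral`: if, for all large levels, the renewal
mass of a suitable set below the level is bounded below and a step leading from it beyond
`e + θ + v` has positive probability, then the mean excess of the first overshoot over `θ` is
bounded away from zero. -/
theorem exists_lt_lintegral_overshoot (hX : IsRenewalSequence μ X) [IsProbabilityMeasure μ]
    {θ v e₀ : ℝ} {c : ℝ≥0∞}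
    (hθ : 0 ≤ θ) (hv : 0 < v) (hc0 : c ≠ 0) (hc1 : c ≠ ⊤) {J : Set ℝ} (hJ : MeasurableSet J)
    (hJ0 : μ.map (X 0) J ≠ 0)
    (h : ∀ e, e₀ ≤ e → ∃ A, MeasurableSet A ∧ c ≤ renewalMeasure μ X A ∧ (∀ z ∈ A, z < e) ∧
      ∀ z ∈ A, ∀ y ∈ J, e + θ + v ≤ z + y) :
    ∃ g₀, 0 < g₀ ∧ ∀ e, e₀ ≤ e → ENNReal.ofReal g₀ ≤
      ∫⁻ ω, ENNReal.ofReal (overshoot (fun n => walk X n ω) e 1 - θ) ∂μ := by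
  have hprob : IsProbabilityMeasure (μ.map (X 0)) :=
    Measure.isProbabilityMeasure_map (hX.meas 0).aemeasurable
  have htop : c * μ.map (X 0) J * ENNReal.ofReal v ≠ ⊤ :=
    ENNReal.mul_ne_top (ENNReal.mul_ne_top hc1 (measure_ne_top _ _)) ENNReal.ofReal_ne_top
  have h0 : c * μ.map (X 0) J * ENNReal.ofReal v ≠ 0 :=
    mul_ne_zero (mul_ne_zero hc0 hJ0) (ENNReal.ofReal_pos.2 hv).ne'
  refine ⟨(c * μ.map (X 0) J * ENNReal.ofReal v).toReal, ENNReal.toReal_pos h0 htop,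
    fun e he => ?_⟩
  obtain ⟨A, hA, hcA, hA1, hA2⟩ := h e he
  rw [ENNReal.ofReal_toReal htop]
  refine le_trans ?_ (hX.renewalMeasure_mul_le_lintegral hθ hv hA hJ hA1 hA2)
  gcongr

/-- If the mean excess of the first overshoot over `θ` is small at a large level `e`, then the
steps are bounded and every overshoot exceeds `θ` by at most a constant multiple of that mean
excess. Unless the steps are bounded by `θ`, they must take values in a lattice; then only
finitely many step sizes occur, and each of them completes the first sample from the last lattice
point below `e` with a probability bounded away from zero. -/
theorem exists_overshoot_bound (hX : IsRenewalSequence μ X) [IsProbabilityMeasure μ]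
    (hint : Integrable (X 0) μ) {θ : ℝ} (hθ : 0 ≤ θ) :
    ∃ B C g₀ e₀ : ℝ, 0 ≤ C ∧ 0 < g₀ ∧ ∀ e g, e₀ ≤ e → 0 < g → g < g₀ →
      ∫⁻ ω, ENNReal.ofReal (overshoot (fun n => walk X n ω) e 1 - θ) ∂μ ≤ ENNReal.ofReal g →
      (∀ᵐ ω ∂μ, ∀ i, X i ω ≤ B) ∧
        ∀ᵐ ω ∂μ, ∀ n, 1 ≤ n → overshoot (fun n => walk X n ω) e n ≤ θ + C * g := by
  have hprob : IsProbabilityMeasure (μ.map (X 0)) :=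
    Measure.isProbabilityMeasure_map (hX.meas 0).aemeasurable
  by_cases hle : μ.map (X 0) (Set.Iic θ)ᶜ = 0
  · have hall := hX.ae_forall_mem measurableSet_Iic hle
    refine ⟨θ, 0, 1, 1, le_rfl, one_pos, fun e g he _ _ _ => ⟨hall, ?_⟩⟩
    filter_upwards [hall, hX.ae_tendsto_walk_atTop hint] with ω h1 h2 n hn
    obtain ⟨s, τ, _, h3, h4, _⟩ := exists_overshoot_eq h2 (by linarith : 0 < e) hn
    have h5 : X τ ω ≤ θ := h1 τ
    rw [h4, walk_succ]
    linarith
  -- a uniform lower bound for the mean excess is incompatible with a small mean excess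
  suffices hsuff : (∃ g₀ e₀, 0 < g₀ ∧ ∀ e, e₀ ≤ e → ENNReal.ofReal g₀ ≤
      ∫⁻ ω, ENNReal.ofReal (overshoot (fun n => walk X n ω) e 1 - θ) ∂μ) ∨
      ∃ B C e₀ : ℝ, 0 ≤ C ∧ ∀ e g, e₀ ≤ e → 0 < g →
        ∫⁻ ω, ENNReal.ofReal (overshoot (fun n => walk X n ω) e 1 - θ) ∂μ ≤ ENNReal.ofReal g →
        (∀ᵐ ω ∂μ, ∀ i, X i ω ≤ B) ∧
          ∀ᵐ ω ∂μ, ∀ n, 1 ≤ n → overshoot (fun n => walk X n ω) e n ≤ θ + C * g by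
    rcases hsuff with ⟨g₀, e₀, hg₀, h⟩ | ⟨B, C, e₀, hC, h⟩
    · refine ⟨0, 0, g₀, e₀, le_rfl, hg₀, fun e g he hg hgg hG => ?_⟩
      exact absurd ((h e he).trans hG) (not_le.2 ((ENNReal.ofReal_lt_ofReal_iff hg₀).2 hgg))
    · exact ⟨B, C, 1, e₀, hC, one_pos, fun e g he hg _ hG => h e g he hg hG⟩
  rcases AddSubgroup.dense_or_cyclic (AddSubgroup.closure (μ.map (X 0)).support) with
    hdense | ⟨a, ha⟩
  · left
    obtain ⟨η, hη, hη0⟩ : ∃ η, 0 < η ∧ μ.map (X 0) (Set.Ici (θ + η)) ≠ 0 := by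
      by_contra! hcon
      refine hle (measure_mono_null (t := ⋃ n : ℕ, Set.Ici (θ + 1 / ((n : ℝ) + 1))) ?_
        (measure_iUnion_null fun n => hcon _ (by positivity)))
      intro x hx
      simp only [Set.mem_compl_iff, Set.mem_Iic, not_le] at hx
      obtain ⟨n, hn⟩ := exists_nat_one_div_lt (sub_pos.2 hx)
      exact Set.mem_iUnion.2 ⟨n, by rw [Set.mem_Ici]; linarith⟩
    obtain ⟨δ, hδ, hδ0, hδη⟩ := hdense.exists_between (show (0 : ℝ) < η / 4 by positivity)
    obtain ⟨c, hc0, hc1, e₀, hc⟩ := hX.exists_le_renewalMeasure_Ioo hint hδ hδ0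
    obtain ⟨g₀, hg₀, h⟩ := hX.exists_lt_lintegral_overshoot (e₀ := e₀) hθ
      (show (0 : ℝ) < η / 4 by positivity) hc0 hc1 measurableSet_Ici hη0 fun e he =>
        ⟨_, measurableSet_Ioo, hc e he, fun z hz => hz.2, fun z hz y hy => by
          have h1 := hz.1
          rw [Set.mem_Ici] at hy
          linarith⟩
    exact ⟨g₀, e₀, hg₀, h⟩
  · obtain ⟨d, hd0, hd⟩ : ∃ d, 0 < d ∧
        AddSubgroup.closure (μ.map (X 0)).support = AddSubgroup.zmultiples d := by
      rw [← AddSubgroup.zmultiples_eq_closure] at ha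
      obtain ⟨x, hx0, hx⟩ := hX.exists_pos_mem_support
      have ha0 : a ≠ 0 := by
        rintro rfl
        have := AddSubgroup.subset_closure hx
        rw [ha] at this
        simp at this
        exact hx0.ne' this
      refine ⟨|a|, abs_pos.2 ha0, ha.trans ?_⟩
      rcases abs_choice a with h | h <;> rw [h]
      rw [AddSubgroup.zmultiples_neg]
    have hsub : (μ.map (X 0)).support ⊆ AddSubgroup.zmultiples d :=
      hd ▸ AddSubgroup.subset_closure
    obtain ⟨c, hc0, hc1, n₀, hc⟩ := hX.exists_le_renewalMeasure_singleton hint hd0 hd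
    -- the last lattice point strictly below the level `e`
    have hlast : ∀ e, ((n₀ : ℝ) + 1) * d ≤ e → ∃ k : ℤ, c ≤ renewalMeasure μ X {(k : ℝ) * d} ∧
        (k : ℝ) * d < e ∧ e ≤ (k + 1) * d := by
      intro e he
      have h1 := Int.le_ceil (e / d)
      have h2 := Int.ceil_lt_add_one (e / d)
      rw [div_le_iff₀ hd0] at h1
      refine ⟨⌈e / d⌉ - 1, hc _ ?_, ?_, ?_⟩
      · have : (n₀ + 1 : ℝ) ≤ ⌈e / d⌉ := le_of_mul_le_mul_right (he.trans h1) hd0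
        have : n₀ + 1 ≤ ⌈e / d⌉ := by exact_mod_cast this
        omega
      · push_cast
        rw [← lt_div_iff₀ hd0]; linarith
      · push_cast; linarith
    by_cases hbd : μ.map (X 0) (Set.Iic (θ + 2 * d))ᶜ = 0
    · right
      set F : Finset ℝ :=
        (Finset.range (⌊(θ + 2 * d) / d⌋₊ + 1)).image fun m : ℕ => (m : ℝ) * d with hF
      set C : ℝ → ℝ := fun x => ((c * μ.map (X 0) {x})⁻¹).toReal with hC
      have hC0 : ∀ x, 0 ≤ C x := fun x => ENNReal.toReal_nonneg
      set Z : Set ℝ := (AddSubgroup.zmultiples d : Set ℝ) with hZdef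
      have hZc : Z.Countable := Set.countable_range fun z : ℤ => z • d
      have hZ0 : μ.map (X 0) Zᶜ = 0 :=
        measure_mono_null (Set.compl_subset_compl.2 hsub) Measure.measure_compl_support
      set N : Set ℝ := {x ∈ Z | μ.map (X 0) {x} = 0}
      have hNc : N.Countable := hZc.mono fun x hx => hx.1
      have hN0 : μ.map (X 0) (Nᶜ)ᶜ = 0 := by
        rw [compl_compl, ← Set.biUnion_of_singleton N]
        exact (measure_biUnion_null_iff hNc).2 fun x hx => hx.2
      have hallB := hX.ae_forall_mem measurableSet_Iic hbd
      have hallZ := hX.ae_forall_mem hZc.measurableSet hZ0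
      have hallN := hX.ae_forall_mem hNc.measurableSet.compl hN0
      refine ⟨θ + 2 * d, ∑ x ∈ F, C x, max 1 ((n₀ + 1) * d),
        Finset.sum_nonneg fun x _ => hC0 x, fun e g he hg hG => ⟨hallB, ?_⟩⟩
      obtain ⟨k, hk1, hk2, hk3⟩ := hlast e ((le_max_right _ _).trans he)
      have he0 : 0 < e := lt_of_lt_of_le one_pos ((le_max_left _ _).trans he)
      filter_upwards [hallB, hallZ, hallN, hX.pos, hX.ae_tendsto_walk_atTop hint]
        with ω hB hZ hN hpos htop n hn
      obtain ⟨s, τ, hsτ, h3, h4, -⟩ := exists_overshoot_eq htop he0 hn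
      have hCsum : 0 ≤ ∑ x ∈ F, C x := Finset.sum_nonneg fun x _ => hC0 x
      -- the part of the sample before its last step is a lattice point below `e`
      have hD : walk X τ ω - walk X s ω ≤ k * d := by
        have hmem : walk X τ ω - walk X s ω ∈ AddSubgroup.zmultiples d :=
          sub_mem (sum_mem fun i _ => hZ i) (sum_mem fun i _ => hZ i)
        obtain ⟨z, hz⟩ := AddSubgroup.mem_zmultiples_iff.1 hmem
        rw [zsmul_eq_mul] at hz
        rw [← hz] at h3 ⊢
        have : (z : ℝ) < k + 1 := lt_of_mul_lt_mul_right (h3.trans_le hk3) hd0.le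
        have : z ≤ k := by
          have : z < k + 1 := by exact_mod_cast this
          omega
        have : (z : ℝ) ≤ k := by exact_mod_cast this
        gcongr
      rw [h4, walk_succ]
      rcases le_or_gt (k * d + X τ ω - e) θ with hsmall | hbig
      · have := mul_nonneg hCsum hg.le
        linarith
      · have hxF : X τ ω ∈ F := by
          obtain ⟨z, hz⟩ := AddSubgroup.mem_zmultiples_iff.1 (hZ τ)
          rw [zsmul_eq_mul] at hz
          have hp := hpos τ
          rw [← hz] at hp
          have hz0 : 0 < z := by
            have : (0 : ℝ) < z := pos_of_mul_pos_left hp hd0.le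
            exact_mod_cast this
          have hzB : X τ ω ≤ θ + 2 * d := hB τ
          rw [hF, Finset.mem_image]
          refine ⟨z.toNat, ?_, ?_⟩
          · rw [Finset.mem_range, Nat.lt_succ_iff]
            refine Nat.le_floor ?_
            rw [le_div_iff₀ hd0]
            have : ((z.toNat : ℕ) : ℝ) = z := by
              exact_mod_cast congrArg (Int.cast : ℤ → ℝ) (Int.toNat_of_nonneg hz0.le)
            rw [this, hz]; exact hzB
          · have : ((z.toNat : ℕ) : ℝ) = z := by
              exact_mod_cast congrArg (Int.cast : ℤ → ℝ) (Int.toNat_of_nonneg hz0.le)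
            simp only [this, hz]
        have hatom : μ.map (X 0) {X τ ω} ≠ 0 := fun h => hN τ ⟨hZ τ, h⟩
        have hmass0 : c * μ.map (X 0) {X τ ω} ≠ 0 := mul_ne_zero hc0 hatom
        have hmass1 : c * μ.map (X 0) {X τ ω} ≠ ⊤ := ENNReal.mul_ne_top hc1 (measure_ne_top _ _)
        set v := k * d + X τ ω - e - θ with hv
        have hlow := hX.renewalMeasure_mul_le_lintegral (e := e) (v := v) (A := {(k : ℝ) * d})
          (J := {X τ ω}) hθ (by linarith) (measurableSet_singleton _) (measurableSet_singleton _)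
          (fun z hz => by rw [Set.mem_singleton_iff.1 hz]; exact hk2)
          (fun z hz y hy => by
            rw [Set.mem_singleton_iff.1 hz, Set.mem_singleton_iff.1 hy]; linarith)
        have h5 : c * μ.map (X 0) {X τ ω} * ENNReal.ofReal v ≤ ENNReal.ofReal g :=
          le_trans (by gcongr) (hlow.trans hG)
        have h6 : v ≤ C (X τ ω) * g := by
          have h7 : ENNReal.ofReal v ≤ (c * μ.map (X 0) {X τ ω})⁻¹ * ENNReal.ofReal g := by
            rwa [← ENNReal.div_eq_inv_mul, ENNReal.le_div_iff_mul_le (Or.inl hmass0)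
              (Or.inl hmass1), mul_comm]
          rw [← ENNReal.ofReal_toReal (ENNReal.inv_ne_top.2 hmass0),
            ← ENNReal.ofReal_mul ENNReal.toReal_nonneg,
            ENNReal.ofReal_le_ofReal_iff (mul_nonneg ENNReal.toReal_nonneg hg.le)] at h7
          exact h7
        have h8 : C (X τ ω) * g ≤ (∑ x ∈ F, C x) * g := by
          gcongr
          exact Finset.single_le_sum (fun x _ => hC0 x) hxF
        linarith
    · left
      obtain ⟨g₀, hg₀, h⟩ := hX.exists_lt_lintegral_overshoot (e₀ := (n₀ + 1) * d) hθ hd0 hc0 hc1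
        measurableSet_Iic.compl hbd fun e he => by
          obtain ⟨k, hk1, hk2, hk3⟩ := hlast e he
          refine ⟨_, measurableSet_singleton _, hk1, fun z hz => ?_, fun z hz y hy => ?_⟩
          · rw [Set.mem_singleton_iff.1 hz]; exact hk2
          · rw [Set.mem_singleton_iff.1 hz]
            simp only [Set.mem_compl_iff, Set.mem_Iic, not_le] at hy
            linarith
      exact ⟨g₀, _, hg₀, h⟩

end IsRenewalSequence

theorem IsRenewalSequence.integrable_of_lintegral_quantization_error {Ω : Type*}
    [MeasurableSpace Ω] {μ : Measure Ω} [IsProbabilityMeasure μ] {X : ℕ → Ω → ℝ}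
    (hX : IsRenewalSequence μ X) {θ e : ℝ} (hθ : 0 < θ) (he : 0 < e) {r : ℕ}
    (hq : ∫⁻ ω, ENNReal.ofReal |quantOvershoot (fun n => walk X n ω) e θ r 1
        - overshoot (fun n => walk X n ω) e 1| ∂μ ≠ ⊤) : Integrable (X 0) μ := by
  refine ⟨(hX.meas 0).aestronglyMeasurable, ?_⟩
  rw [hasFiniteIntegral_iff_ofReal (by filter_upwards [hX.pos] with ω h using (h 0).le)]
  refine lt_of_le_of_lt (lintegral_mono_ae (g := fun ω => ENNReal.ofReal (e + θ) +
    ENNReal.ofReal |quantOvershoot (fun n => walk X n ω) e θ r 1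
        - overshoot (fun n => walk X n ω) e 1|) ?_) ?_
  · filter_upwards [hX.monotone_walk] with ω hmono
    rw [← ENNReal.ofReal_add (by positivity) (abs_nonneg _)]
    refine ENNReal.ofReal_le_ofReal ?_
    have habs := neg_abs_le (quantOvershoot (fun n => walk X n ω) e θ r 1
        - overshoot (fun n => walk X n ω) e 1)
    have habs0 := abs_nonneg (quantOvershoot (fun n => walk X n ω) e θ r 1
        - overshoot (fun n => walk X n ω) e 1)
    rcases lt_or_ge (X 0 ω) e with h | h
    · linarith
    · have h1 : overshoot (fun n => walk X n ω) e 1 = X 0 ω - e := by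
        rw [overshoot, sampleTime_one_eq (n := 0) (by simp [walk]) hmono (by simpa [walk])
          (by simpa [walk])]
        simp [walk, sampleTime]
      have h2 : quantOvershoot (fun n => walk X n ω) e θ r 1 ≤ θ := by
        have := midRiser_le hθ (N := 2 ^ r) (by positivity)
          (overshoot (fun n => walk X n ω) e 1)
        have h3 : 0 ≤ θ / (2 * ((2 ^ r : ℕ) : ℝ)) := by positivity
        rw [quantOvershoot]
        linarith
      linarith
  · rw [lintegral_add_left measurable_const, lintegral_const]
    simp only [measure_univ, mul_one]
    exact ENNReal.add_lt_top.2 ⟨ENNReal.ofReal_lt_top, lt_top_iff_ne_top.2 hq⟩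

/-- The requirement that the mean quantization error of an overshoot be below half a cell turns
into an almost sure bound by a constant number of cells, once the threshold and the number of bits
are large. -/
theorem IsRenewalSequence.exists_quantization_error_bound {Ω : Type*} [MeasurableSpace Ω]
    {μ : Measure Ω} [IsProbabilityMeasure μ] {X : ℕ → Ω → ℝ} (hX : IsRenewalSequence μ X)
    {θ : ℝ} (hθ : 0 < θ) {e : ℕ → ℝ} {r : ℕ → ℕ} (he : Tendsto e atTop atTop)
    (hr : Tendsto r atTop atTop)
    (hq : ∀ᶠ j in atTop, ∀ n, 1 ≤ n →
      ∫⁻ ω, ENNReal.ofReal |quantOvershoot (fun n => walk X n ω) (e j) θ (r j) n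
        - overshoot (fun n => walk X n ω) (e j) n| ∂μ < ENNReal.ofReal (θ / 2 ^ (r j + 1))) :
    Integrable (X 0) μ ∧ ∃ B C : ℝ, 0 ≤ C ∧ ∀ᶠ j in atTop, (∀ᵐ ω ∂μ, ∀ i, X i ω ≤ B) ∧
      ∀ᵐ ω ∂μ, ∀ n, 1 ≤ n → |quantOvershoot (fun n => walk X n ω) (e j) θ (r j) n
        - overshoot (fun n => walk X n ω) (e j) n| ≤ C / 2 ^ r j := by
  have hint : Integrable (X 0) μ := by
    obtain ⟨j, h1, h2⟩ := (hq.and (he.eventually_gt_atTop 0)).exists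
    exact hX.integrable_of_lintegral_quantization_error hθ h2 ((h1 1 le_rfl).trans_le le_top).ne
  refine ⟨hint, ?_⟩
  obtain ⟨B, C, g₀, e₀, hC, hg₀, h⟩ := hX.exists_overshoot_bound hint hθ.le
  refine ⟨B, (1 + C) * (θ / 2), by positivity, ?_⟩
  have hsmall : Tendsto (fun j => θ / 2 ^ (r j + 1)) atTop (𝓝 0) := by
    refine Tendsto.div_atTop tendsto_const_nhds ?_
    exact (tendsto_pow_atTop_atTop_of_one_lt one_lt_two).comp ((tendsto_add_atTop_nat 1).comp hr)
  filter_upwards [hq, he.eventually_ge_atTop e₀, he.eventually_gt_atTop 0,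
    hsmall.eventually_lt_const hg₀] with j hqj he1 he2 hs
  have hcell : θ / (2 * ((2 ^ r j : ℕ) : ℝ)) = θ / 2 ^ (r j + 1) := by
    push_cast; rw [pow_succ]; ring
  obtain ⟨hB, hov⟩ := h (e j) (θ / 2 ^ (r j + 1)) he1 (by positivity) hs (by
    refine le_trans (lintegral_mono fun ω => ENNReal.ofReal_le_ofReal ?_) (hqj 1 le_rfl).le
    have h1 := midRiser_le hθ (N := 2 ^ r j) (by positivity)
      (overshoot (fun n => walk X n ω) (e j) 1)
    have h2 : 0 ≤ θ / (2 * ((2 ^ r j : ℕ) : ℝ)) := by positivity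
    have h3 := neg_abs_le (quantOvershoot (fun n => walk X n ω) (e j) θ (r j) 1
      - overshoot (fun n => walk X n ω) (e j) 1)
    rw [quantOvershoot] at h3 ⊢
    linarith)
  refine ⟨hB, ?_⟩
  filter_upwards [hov, hX.ae_tendsto_walk_atTop hint] with ω h1 h2 n hn
  obtain ⟨-, -, -, -, -, h3⟩ := exists_overshoot_eq h2 he2 hn
  have h4 := abs_midRiser_sub_le hθ (N := 2 ^ r j) (by positivity) h3
  rw [hcell] at h4
  rw [quantOvershoot]
  have h5 : max (overshoot (fun n => walk X n ω) (e j) n - θ) 0 ≤ C * (θ / 2 ^ (r j + 1)) :=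
    max_le (by linarith [h1 n hn]) (by positivity)
  calc _ ≤ θ / 2 ^ (r j + 1) + C * (θ / 2 ^ (r j + 1)) := by linarith
    _ = (1 + C) * (θ / 2) / 2 ^ r j := by rw [pow_succ]; field_simp

/-! ### Stopping when the recovered information reaches the target -/

section Stopping

variable {K : ℕ} {D : Design K} {σ : Fin K → ℝ} {H : Fin K → ℕ → ℂ}

theorem condFisherInfo_succ (t : ℕ) :
    condFisherInfo σ H (t + 1) = condFisherInfo σ H t + ∑ k, 2 * ‖H k t‖ ^ 2 / σ k ^ 2 := by
  simp only [condFisherInfo, localU, Finset.sum_range_succ, Finset.sum_add_distrib]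

theorem localU_nonneg (k : Fin K) (t : ℕ) : 0 ≤ localU σ H k t :=
  Finset.sum_nonneg fun _ _ => by positivity

theorem condFisherInfo_nonneg (t : ℕ) : 0 ≤ condFisherInfo σ H t :=
  Finset.sum_nonneg fun k _ => localU_nonneg k t

theorem monotone_localU (k : Fin K) : Monotone (localU σ H k) :=
  monotone_nat_of_le_succ fun n => by
    rw [localU, localU, Finset.sum_range_succ]
    have : 0 ≤ 2 * ‖H k n‖ ^ 2 / σ k ^ 2 := by positivity
    linarith

/-- With all quantization errors of the overshoots of sensor `k` bounded by `δ k`, the fused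
information differs from the conditional Fisher information by at most one threshold per sensor
plus a small fraction of the information. -/
theorem abs_fusedU_sub_le (htop : ∀ k, Tendsto (localU σ H k) atTop atTop)
    (he : ∀ k, 0 < D.e k) {δ : Fin K → ℝ} (hδ : ∀ k, 0 ≤ δ k)
    (hq : ∀ k n, 1 ≤ n → |quantOvershoot (localU σ H k) (D.e k) (D.θ k) D.rU n
        - overshoot (localU σ H k) (D.e k) n| ≤ δ k) (t : ℕ) :
    |fusedU D σ H t - condFisherInfo σ H t| ≤
      ∑ k, D.e k + condFisherInfo σ H t * ∑ k, δ k / D.e k := by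
  rw [fusedU, condFisherInfo, ← Finset.sum_sub_distrib]
  refine (Finset.abs_sum_le_sum_abs _ _).trans ?_
  rw [Finset.mul_sum, ← Finset.sum_add_distrib]
  refine Finset.sum_le_sum fun k _ => ?_
  refine (abs_recovered_sub_le (by simp [localU]) (monotone_localU k) (htop k) (he k) (hδ k)
    (hq k) t).trans ?_
  have : 0 ≤ δ k / D.e k := div_nonneg (hδ k) (he k).le
  gcongr
  exact Finset.single_le_sum (f := fun k => localU σ H k t)
    (fun k _ => localU_nonneg k t) (Finset.mem_univ k)

/-- At the stopping time the conditional Fisher information is of the order of the target, as is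
the information one step earlier. -/
theorem stopTime_spec {E η B : ℝ} (hη : η ≤ 1 / 4)
    (hE : E ≤ D.target / 4) (hB : B ≤ D.target) (hI : 0 < D.target)
    (htop : Tendsto (condFisherInfo σ H) atTop atTop)
    (hbd : ∀ t, |fusedU D σ H t - condFisherInfo σ H t| ≤ E + condFisherInfo σ H t * η)
    (hstep : ∀ t, ∑ k, 2 * ‖H k t‖ ^ 2 / σ k ^ 2 ≤ B) :
    D.target ≤ fusedU D σ H (stopTime D σ H) ∧
      condFisherInfo σ H (stopTime D σ H - 1) ≤ 2 * D.target ∧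
      condFisherInfo σ H (stopTime D σ H) ≤ 3 * D.target ∧
      D.target / 2 ≤ condFisherInfo σ H (stopTime D σ H) := by
  have hU0 := condFisherInfo_nonneg (σ := σ) (H := H)
  have hmem : D.target ≤ fusedU D σ H (stopTime D σ H) := by
    refine Nat.sInf_mem (s := {t : ℕ | D.target ≤ fusedU D σ H t}) ?_
    obtain ⟨t, ht⟩ := (htop.eventually_ge_atTop (2 * D.target)).exists
    refine ⟨t, ?_⟩
    have h1 := (abs_le.1 (hbd t)).1
    have h2 : condFisherInfo σ H t * η ≤ condFisherInfo σ H t * (1 / 4) := by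
      gcongr; exact hU0 t
    change D.target ≤ fusedU D σ H t
    linarith
  set T := stopTime D σ H with hT
  have hT0 : T ≠ 0 := by
    intro h
    have h0 : fusedU D σ H 0 = 0 := by simp [fusedU, recovered, messageCount]
    rw [h, h0] at hmem
    linarith
  have hprev : fusedU D σ H (T - 1) < D.target := by
    by_contra hc
    push Not at hc
    have hle : T ≤ T - 1 := Nat.sInf_le (s := {t : ℕ | D.target ≤ fusedU D σ H t}) hc
    omega
  have h1 := (abs_le.1 (hbd (T - 1))).1
  have h2 : condFisherInfo σ H (T - 1) * η ≤ condFisherInfo σ H (T - 1) * (1 / 4) := by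
    gcongr; exact hU0 _
  have h3 : condFisherInfo σ H (T - 1) ≤ 2 * D.target := by linarith
  have h4 : condFisherInfo σ H T ≤ condFisherInfo σ H (T - 1) + B := by
    obtain ⟨m, hm⟩ : ∃ m, T = m + 1 := ⟨T - 1, by omega⟩
    rw [hm, condFisherInfo_succ, Nat.add_sub_cancel]
    linarith [hstep m]
  have h5 := (abs_le.1 (hbd T)).2
  have h6 : condFisherInfo σ H T * η ≤ condFisherInfo σ H T * (1 / 4) := by
    gcongr; exact hU0 _
  exact ⟨hmem, h3, by linarith, by linarith⟩

end Stopping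

/-! ### Measurability of the stopping time and of the statistics -/

section Measurability

variable {α : Type*} [MeasurableSpace α]

theorem measurable_sInf_nat {P : α → ℕ → Prop} (h : ∀ t, MeasurableSet {a | P a t}) :
    Measurable fun a => sInf {t : ℕ | P a t} := by
  refine measurable_to_countable' fun m => ?_
  have : (fun a => sInf {t : ℕ | P a t}) ⁻¹' {m} =
      ({a | P a m} ∩ ⋂ k : ℕ, ⋂ _ : k < m, {a | P a k}ᶜ) ∪
        ({_a : α | m = 0} ∩ ⋂ k : ℕ, {a | P a k}ᶜ) := by
    ext a
    simp only [Set.mem_preimage, Set.mem_singleton_iff, Set.mem_union, Set.mem_inter_iff,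
      Set.mem_iInter, Set.mem_compl_iff, Set.mem_ofPred_eq]
    constructor
    · rintro rfl
      rcases Set.eq_empty_or_nonempty {t : ℕ | P a t} with he | hne
      · right
        refine ⟨by rw [he, Nat.sInf_empty], fun k hk => ?_⟩
        have : k ∈ {t : ℕ | P a t} := hk
        rw [he] at this; exact this
      · left
        exact ⟨Nat.sInf_mem hne, fun k hk => Nat.notMem_of_lt_sInf hk⟩
    · rintro (⟨h1, h2⟩ | ⟨rfl, h2⟩)
      · refine le_antisymm (Nat.sInf_le h1) (le_csInf ⟨m, h1⟩ fun k hk => ?_)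
        by_contra hc
        exact h2 k (not_le.1 hc) hk
      · have : {t : ℕ | P a t} = ∅ := Set.eq_empty_iff_forall_notMem.2 h2
        rw [this, Nat.sInf_empty]
  rw [this]
  exact ((h m).inter (.iInter fun k => .iInter fun _ => (h k).compl)).union
    ((MeasurableSet.const _).inter (.iInter fun k => (h k).compl))

/-- Evaluating a sequence of measurable functions at a measurable random index. -/
theorem measurable_apply_nat {β : Type*} [MeasurableSpace β] {f : ℕ → α → β} {T : α → ℕ}
    (hf : ∀ n, Measurable (f n)) (hT : Measurable T) : Measurable fun a => f (T a) a :=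
  (measurable_from_prod_countable_right (f := fun p : ℕ × α => f p.1 p.2) hf).comp
    (hT.prodMk measurable_id)

variable {U : α → ℕ → ℝ}

theorem measurable_sampleTime (hU : ∀ t, Measurable fun a => U a t) (e : ℝ) (n : ℕ) :
    Measurable fun a => sampleTime (U a) e n := by
  induction n with
  | zero => exact measurable_const
  | succ n ih =>
    refine measurable_sInf_nat (P := fun a t => sampleTime (U a) e n < t ∧
      e ≤ U a t - U a (sampleTime (U a) e n)) fun t => ?_
    exact (measurableSet_lt ih measurable_const).inter
      (measurableSet_le measurable_const ((hU t).sub (measurable_apply_nat hU ih)))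

theorem measurable_messageCount (hU : ∀ t, Measurable fun a => U a t) (e : ℝ) (t : ℕ) :
    Measurable fun a => messageCount (U a) e t := by
  simp only [messageCount, Finset.card_filter]
  exact Finset.measurable_sum _ fun n _ => Measurable.ite
    (measurableSet_le (measurable_sampleTime hU e n) measurable_const)
    measurable_const measurable_const

theorem measurable_midRiser {lo len v : α → ℝ} (N : ℕ) (hlo : Measurable lo)
    (hlen : Measurable len) (hv : Measurable v) :
    Measurable fun a => midRiser (lo a) (len a) N (v a) := by
  have h1 : Measurable fun a => ⌊(v a - lo a) / (len a / N)⌋ :=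
    ((hv.sub hlo).div (hlen.div_const _)).floor
  have h2 : Measurable fun z : ℤ => ((max 0 (min ((N : ℤ) - 1) z) : ℤ) : ℝ) :=
    measurable_from_top
  exact hlo.add (((h2.comp h1).add_const _).mul (hlen.div_const _))

theorem measurable_recovered (hU : ∀ t, Measurable fun a => U a t) (e θ : ℝ) (r t : ℕ) :
    Measurable fun a => recovered (U a) e θ r t := by
  refine measurable_apply_nat
    (f := fun m a => ∑ n ∈ Finset.Icc 1 m, (e + quantOvershoot (U a) e θ r n))
    (fun m => Finset.measurable_sum _ fun n _ => measurable_const.add ?_)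
    (measurable_messageCount hU e t)
  exact measurable_midRiser _ measurable_const measurable_const
    (((measurable_apply_nat hU (measurable_sampleTime hU e n)).sub
      (measurable_apply_nat hU (measurable_sampleTime hU e (n - 1)))).sub_const _)

variable {K : ℕ} {H W : α → Fin K → ℕ → ℂ}

theorem measurable_entry (hH : Measurable H) (k : Fin K) (τ : ℕ) :
    Measurable fun a => H a k τ :=
  (measurable_pi_apply τ).comp ((measurable_pi_apply k).comp hH)

theorem measurable_localU (σ : Fin K → ℝ) (hH : Measurable H) (k : Fin K) (t : ℕ) :
    Measurable fun a => localU σ (H a) k t :=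
  Finset.measurable_sum _ fun τ _ =>
    (((measurable_entry hH k τ).norm.pow_const 2).const_mul 2).div_const _

theorem measurable_condFisherInfo (σ : Fin K → ℝ) (hH : Measurable H) (t : ℕ) :
    Measurable fun a => condFisherInfo σ (H a) t :=
  Finset.measurable_sum _ fun k _ => measurable_localU σ hH k t

theorem measurable_fusedU (D : Design K) (σ : Fin K → ℝ) (hH : Measurable H) (t : ℕ) :
    Measurable fun a => fusedU D σ (H a) t :=
  Finset.measurable_sum _ fun k _ => measurable_recovered (measurable_localU σ hH k) _ _ _ _

theorem measurable_stopTime (D : Design K) (σ : Fin K → ℝ) (hH : Measurable H) :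
    Measurable fun a => stopTime D σ (H a) :=
  measurable_sInf_nat fun t => measurableSet_le measurable_const (measurable_fusedU D σ hH t)

theorem measurable_history (D : Design K) (σ : Fin K → ℝ) (hH : Measurable H) :
    Measurable fun a => history D σ (H a) :=
  measurable_pi_lambda _ fun k => measurable_pi_lambda _ fun τ =>
    Measurable.ite (measurableSet_lt measurable_const (measurable_stopTime D σ hH))
      (measurable_entry hH k τ) measurable_const

theorem measurable_localV (σ : Fin K → ℝ) (x : ℂ) (hH : Measurable H) (hW : Measurable W)
    (k : Fin K) (t : ℕ) : Measurable fun a => localV σ x (H a) (W a) k t := by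
  refine Finset.measurable_sum _ fun τ _ => ?_
  have h1 := measurable_entry hH k τ
  have h2 := measurable_entry hW k τ
  have h3 : Measurable fun a => starRingEnd ℂ (H a k τ) * obs x (H a) (W a) k τ :=
    (Complex.continuous_conj.measurable.comp h1).mul ((h1.const_mul x).add h2)
  exact ((Complex.measurable_re.comp h3).const_mul 2).div_const _

theorem measurable_stoppedV (D : Design K) (σ : Fin K → ℝ) (x : ℂ) (hH : Measurable H)
    (hW : Measurable W) (k : Fin K) : Measurable fun a => stoppedV D σ x (H a) (W a) k :=
  measurable_apply_nat (fun t => measurable_localV σ x hH hW k t) (measurable_stopTime D σ hH)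

theorem measurable_quantV (D : Design K) (σ : Fin K → ℝ) (x : ℂ) (hH : Measurable H)
    (hW : Measurable W) (k : Fin K) : Measurable fun a => quantV D σ x (H a) (W a) k := by
  have h1 : Measurable fun a => (stopTime D σ (H a) : ℝ) * D.φ k :=
    ((measurable_from_top (f := fun n : ℕ => (n : ℝ))).comp
      (measurable_stopTime D σ hH)).mul_const _
  exact measurable_midRiser _ h1.neg (h1.const_mul 2) (measurable_stoppedV D σ x hH hW k)

theorem measurable_normalizedError (D : Design K) (σ : Fin K → ℝ) (x : ℂ) (hH : Measurable H)
    (hW : Measurable W) : Measurable fun a => normalizedError D σ x (H a) (W a) := by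
  have hT := measurable_stopTime D σ hH
  exact (measurable_apply_nat (measurable_condFisherInfo σ hH) hT).sqrt.mul
    (((Finset.measurable_sum _ fun k _ => measurable_quantV D σ x hH hW k).div
      (measurable_apply_nat (measurable_fusedU D σ hH) hT)).sub_const _)

end Measurability

/-! ### The unquantized normalized error is standard normal given the channels -/

/-- The noise part of the sum of the statistics `V^k` at time `t`. -/
noncomputable def fusedNoise {K : ℕ} (σ : Fin K → ℝ) (H W : Fin K → ℕ → ℂ) (t : ℕ) : ℝ :=
  ∑ k, ∑ τ ∈ Finset.range t, 2 * (starRingEnd ℂ (H k τ) * W k τ).re / σ k ^ 2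

theorem sum_localV {K : ℕ} (σ : Fin K → ℝ) (x : ℂ) (H W : Fin K → ℕ → ℂ) (t : ℕ) :
    ∑ k, localV σ x H W k t = x.re * condFisherInfo σ H t + fusedNoise σ H W t := by
  rw [condFisherInfo, fusedNoise, Finset.mul_sum, ← Finset.sum_add_distrib]
  refine Finset.sum_congr rfl fun k _ => ?_
  rw [localV, localU, Finset.mul_sum, ← Finset.sum_add_distrib]
  refine Finset.sum_congr rfl fun τ _ => ?_
  rw [obs, ← Complex.normSq_eq_norm_sq, Complex.normSq_apply]
  simp only [Complex.mul_re, Complex.add_re, Complex.conj_re, Complex.conj_im, Complex.add_im,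
    Complex.mul_im]
  ring

theorem measurable_fusedNoise {α : Type*} [MeasurableSpace α] {K : ℕ} (σ : Fin K → ℝ)
    {H W : α → Fin K → ℕ → ℂ} (hH : Measurable H) (hW : Measurable W) (t : ℕ) :
    Measurable fun a => fusedNoise σ (H a) (W a) t := by
  refine Finset.measurable_sum _ fun k _ => Finset.measurable_sum _ fun τ _ => ?_
  exact ((Complex.measurable_re.comp ((Complex.continuous_conj.measurable.comp
    (measurable_entry hH k τ)).mul (measurable_entry hW k τ))).const_mul 2).div_const _

theorem map_re_mul_complexGaussian (v : ℝ≥0) (c : ℂ) :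
    (complexGaussian v).map (fun z => (c * z).re) = gaussianReal 0 (‖c‖₊ ^ 2 * (v / 2)) := by
  set γ := gaussianReal 0 (v / 2)
  have hm : Measurable fun p : ℝ × ℝ => (⟨p.1, p.2⟩ : ℂ) :=
    Complex.measurableEquivRealProd.symm.measurable
  have hm' : Measurable fun z : ℂ => (c * z).re :=
    Complex.measurable_re.comp (measurable_id.const_mul c)
  have hfst : (γ.prod γ).map Prod.fst = γ := by
    simp
  have hsnd : (γ.prod γ).map Prod.snd = γ := by
    simp
  have h1 : (γ.prod γ).map (fun p => c.re * p.1) = gaussianReal 0 (‖c.re‖₊ ^ 2 * (v / 2)) := by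
    rw [show (fun p : ℝ × ℝ => c.re * p.1) = (fun y => c.re * y) ∘ Prod.fst from rfl,
      ← Measure.map_map (measurable_const_mul _) measurable_fst, hfst,
      gaussianReal_map_const_mul]
    congr 1
    · simp
    · congr 1; ext; simp
  have h2 : (γ.prod γ).map (fun p => -c.im * p.2) = gaussianReal 0 (‖c.im‖₊ ^ 2 * (v / 2)) := by
    rw [show (fun p : ℝ × ℝ => -c.im * p.2) = (fun y => -c.im * y) ∘ Prod.snd from rfl,
      ← Measure.map_map (measurable_const_mul _) measurable_snd, hsnd,
      gaussianReal_map_const_mul]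
    congr 1
    · simp
    · congr 1; ext; simp
  have hind : IndepFun (fun p : ℝ × ℝ => c.re * p.1) (fun p => -c.im * p.2) (γ.prod γ) :=
    indepFun_prod (measurable_const_mul c.re) (measurable_const_mul (-c.im))
  have h3 := gaussianReal_add_gaussianReal_of_indepFun hind h1 h2
  rw [complexGaussian, Measure.map_map hm' hm]
  convert! h3 using 2
  · ext p
    simp [Complex.mul_re]; ring
  · simp
  · rw [← add_mul]
    congr 1
    ext
    simp only [NNReal.coe_pow, NNReal.coe_add, coe_nnnorm, Real.norm_eq_abs, sq_abs]
    rw [← Complex.normSq_eq_norm_sq, Complex.normSq_apply]; ring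

theorem map_finset_sum_gaussian {Ω ι : Type*} [MeasurableSpace Ω] {μ : Measure Ω}
    [IsProbabilityMeasure μ] {f : ι → Ω → ℝ} (hf : ∀ i, Measurable (f i)) (hind : iIndepFun f μ)
    {v : ι → ℝ≥0} (hlaw : ∀ i, μ.map (f i) = gaussianReal 0 (v i)) (s : Finset ι) :
    μ.map (∑ i ∈ s, f i) = gaussianReal 0 (∑ i ∈ s, v i) := by
  classical
  induction s using Finset.induction_on with
  | empty =>
    rw [Finset.sum_empty, Finset.sum_empty, gaussianReal_zero_var]
    have : (0 : Ω → ℝ) = fun _ => 0 := rfl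
    rw [this, Measure.map_const]; simp
  | insert i s his ih =>
    rw [Finset.sum_insert his, Finset.sum_insert his, add_comm, add_comm (v i)]
    have := gaussianReal_add_gaussianReal_of_indepFun
      (hind.indepFun_finsetSum_of_notMem hf his) ih (hlaw i)
    simpa using this

section Noise

variable {Ω : Type*} [MeasurableSpace Ω] {μ : Measure Ω} [IsProbabilityMeasure μ] {K : ℕ}
  {σ : Fin K → ℝ} {w : Ω → Fin K → ℕ → ℂ}

/-- For fixed channel gains the noise part of the fused statistic is centered normal, with variance
the conditional Fisher information. -/
theorem map_fusedNoise (hσ : ∀ k, 0 < σ k) (hw : Measurable w)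
    (w_indep : iIndepFun (fun (i : Fin K × ℕ) ω => w ω i.1 i.2) μ)
    (w_law : ∀ k τ, μ.map (fun ω => w ω k τ) = complexGaussian (Real.toNNReal (σ k ^ 2)))
    (H : Fin K → ℕ → ℂ) (t : ℕ) :
    μ.map (fun ω => fusedNoise σ H (w ω) t) =
      gaussianReal 0 (Real.toNNReal (condFisherInfo σ H t)) := by
  set c : Fin K × ℕ → ℂ := fun i => (2 / σ i.1 ^ 2 : ℝ) * starRingEnd ℂ (H i.1 i.2) with hc
  have hre : ∀ i : Fin K × ℕ, Measurable fun z : ℂ => (c i * z).re := fun i =>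
    Complex.measurable_re.comp (measurable_id.const_mul _)
  have hlaw : ∀ i : Fin K × ℕ, μ.map (fun ω => (c i * w ω i.1 i.2).re) =
      gaussianReal 0 (‖c i‖₊ ^ 2 * (Real.toNNReal (σ i.1 ^ 2) / 2)) := by
    intro i
    rw [← map_re_mul_complexGaussian, ← w_law i.1 i.2,
      Measure.map_map (hre i) (measurable_entry hw _ _)]
    rfl
  have h := map_finset_sum_gaussian
    (f := fun (i : Fin K × ℕ) ω => (c i * w ω i.1 i.2).re)
    (fun i => (hre i).comp (measurable_entry hw _ _))
    (w_indep.comp (fun i z => (c i * z).re) hre) hlaw (Finset.univ ×ˢ Finset.range t)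
  convert! h using 2
  · ext ω
    rw [Finset.sum_apply, Finset.sum_product, fusedNoise]
    refine Finset.sum_congr rfl fun k _ => Finset.sum_congr rfl fun τ _ => ?_
    simp only [hc]
    rw [mul_assoc, Complex.re_ofReal_mul]
    ring
  · ext
    rw [Real.coe_toNNReal _ (condFisherInfo_nonneg t)]
    push_cast
    rw [Finset.sum_product, condFisherInfo]
    refine Finset.sum_congr rfl fun k _ => Finset.sum_congr rfl fun τ _ => ?_
    have := (hσ k).ne'
    simp only [hc, norm_mul, RCLike.norm_conj, Complex.norm_real, Real.norm_eq_abs]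
    rw [Real.coe_toNNReal _ (by positivity), mul_pow, sq_abs]
    field_simp

/-- The same variable, normalized at a time where the information is positive. -/
theorem map_fusedNoise_div_sqrt (hσ : ∀ k, 0 < σ k) (hw : Measurable w)
    (w_indep : iIndepFun (fun (i : Fin K × ℕ) ω => w ω i.1 i.2) μ)
    (w_law : ∀ k τ, μ.map (fun ω => w ω k τ) = complexGaussian (Real.toNNReal (σ k ^ 2)))
    (H : Fin K → ℕ → ℂ) (t : ℕ) (hpos : 0 < condFisherInfo σ H t) :
    μ.map (fun ω => fusedNoise σ H (w ω) t / √(condFisherInfo σ H t)) = gaussianReal 0 1 := by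
  have h := map_fusedNoise hσ hw w_indep w_law H t
  rw [show (fun ω => fusedNoise σ H (w ω) t / √(condFisherInfo σ H t)) =
    (fun y => y / √(condFisherInfo σ H t)) ∘ fun ω => fusedNoise σ H (w ω) t from rfl,
    ← Measure.map_map (by fun_prop)
      (measurable_fusedNoise σ (H := fun _ => H) measurable_const hw t), h,
    gaussianReal_map_div_const]
  congr 1
  · simp
  · ext
    rw [NNReal.coe_div, Real.coe_toNNReal _ hpos.le]
    simp [Real.sq_sqrt hpos.le, div_self hpos.ne']

end Noise

/-- If `h` and `w` are independent and, for almost every value of `h`, the variable `F h w` has law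
`γ`, then `F h w` has law `γ` and is independent of every function of `h`. -/
theorem map_prodMk_eq_prod_of_indepFun {Ω A B C E : Type*} [MeasurableSpace Ω] [MeasurableSpace A]
    [MeasurableSpace B] [MeasurableSpace C] [MeasurableSpace E] {μ : Measure Ω}
    [IsProbabilityMeasure μ] {h : Ω → A} {w : Ω → B} (hh : Measurable h) (hw : Measurable w)
    (hind : IndepFun h w μ) {G : A → C} (hG : Measurable G) {F : A → B → E}
    (hF : Measurable (Function.uncurry F)) {γ : Measure E} [IsProbabilityMeasure γ]
    (hlaw : ∀ᵐ ω ∂μ, μ.map (fun ω' => F (h ω) (w ω')) = γ) :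
    μ.map (fun ω => (G (h ω), F (h ω) (w ω))) = (μ.map (fun ω => G (h ω))).prod γ := by
  have hm1 : Measurable fun ω => G (h ω) := hG.comp hh
  have hm2 : Measurable fun ω => F (h ω) (w ω) := hF.comp (hh.prodMk hw)
  have : IsProbabilityMeasure (μ.map (fun ω => G (h ω))) :=
    Measure.isProbabilityMeasure_map hm1.aemeasurable
  have : IsProbabilityMeasure (μ.map w) := Measure.isProbabilityMeasure_map hw.aemeasurable
  have : IsProbabilityMeasure (μ.map h) := Measure.isProbabilityMeasure_map hh.aemeasurable
  refine (Measure.prod_eq fun s t hs ht => ?_).symm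
  have hS : MeasurableSet {p : A × B | G p.1 ∈ s ∧ F p.1 p.2 ∈ t} :=
    (hG.comp measurable_fst hs).inter (hF ht)
  rw [Measure.map_apply (hm1.prodMk hm2) (hs.prod ht)]
  have h1 : (fun ω => (G (h ω), F (h ω) (w ω))) ⁻¹' s ×ˢ t =
      (fun ω => (h ω, w ω)) ⁻¹' {p : A × B | G p.1 ∈ s ∧ F p.1 p.2 ∈ t} := rfl
  rw [h1, ← Measure.map_apply (hh.prodMk hw) hS,
    (indepFun_iff_map_prod_eq_prod_map_map hh.aemeasurable hw.aemeasurable).1 hind,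
    Measure.prod_apply hS, lintegral_map (measurable_measure_prodMk_left hS) hh]
  have h2 : ∀ᵐ ω ∂μ, μ.map w (Prod.mk (h ω) ⁻¹' {p : A × B | G p.1 ∈ s ∧ F p.1 p.2 ∈ t}) =
      ((fun ω => G (h ω)) ⁻¹' s).indicator (fun _ => γ t) ω := by
    filter_upwards [hlaw] with ω hω
    have hFω : Measurable (F (h ω)) := hF.comp measurable_prodMk_left
    by_cases hmem : G (h ω) ∈ s
    · rw [Set.indicator_of_mem (by exact hmem), ← hω,
        Measure.map_apply (f := fun ω' => F (h ω) (w ω')) (hFω.comp hw) ht,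
        Measure.map_apply hw (measurable_prodMk_left hS)]
      congr 1
      ext ω'
      simp [hmem]
    · rw [Set.indicator_of_notMem (by exact hmem)]
      convert! measure_empty (μ := μ.map w)
      ext b
      simp [hmem]
  rw [lintegral_congr_ae h2, lintegral_indicator_const (hm1 hs), Measure.map_apply hm1 hs,
    mul_comm]

/-! ### Comparison of conditional laws -/

section Comparison

variable {Ω β : Type*} [MeasurableSpace Ω] [MeasurableSpace β] {μ : Measure Ω}
  [IsProbabilityMeasure μ]

/-- A pointwise bound of `|Z - Z₀|` by `a |Z₀| + b + c ∑ |εₖ|` with constants `a`, `b`, `c` bounds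
the distance of the conditional laws of `Z` and `Z₀` tested against Lipschitz functions, by the
same expression in the conditional means. Both sides are computed in the conditional law of the
triple `(Z₀, Z, ε)`. -/
theorem abs_integral_condDistrib_sub_le {K : ℕ} {X : Ω → β} (hX : Measurable X)
    {Z₀ Z : Ω → ℝ} {ε : Fin K → Ω → ℝ} (hZ₀ : Measurable Z₀) (hZ : Measurable Z)
    (hε : ∀ k, Measurable (ε k)) {γ : Measure ℝ} [IsProbabilityMeasure γ]
    (hγ : Integrable (fun z => z) γ)
    (hlaw : μ.map (fun ω => (X ω, Z₀ ω)) = (μ.map X).prod γ) {a b c : ℝ} (ha : 0 ≤ a)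
    (hb : 0 ≤ b) (hc : 0 ≤ c) (hbound : ∀ᵐ ω ∂μ, |Z ω - Z₀ ω| ≤ a * |Z₀ ω| + b + c * ∑ k, |ε k ω|) :
    ∀ᵐ ω ∂μ, ∀ (f : ℝ → ℝ) (L : ℝ≥0) (C : ℝ) (m : Fin K → ℝ), LipschitzWith L f →
      (∀ x y, dist (f x) (f y) ≤ C) → (∀ k, 0 ≤ m k) →
      (∀ k, ∫⁻ z, ENNReal.ofReal |z| ∂(condDistrib (ε k) X μ (X ω)) ≤ ENNReal.ofReal (m k)) →
      |∫ z, f z ∂(condDistrib Z X μ (X ω)) - ∫ z, f z ∂γ| ≤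
        L * (a * ∫ z, |z| ∂γ + b + c * ∑ k, m k) := by
  set Y : Ω → ℝ × ℝ × (Fin K → ℝ) := fun ω => (Z₀ ω, Z ω, fun k => ε k ω) with hY
  have hYm : Measurable Y := hZ₀.prodMk (hZ.prodMk (measurable_pi_lambda _ hε))
  have e0 : condDistrib Z₀ X μ =ᵐ[μ.map X] (condDistrib Y X μ).map Prod.fst :=
    condDistrib_comp X hYm.aemeasurable (f := Prod.fst) measurable_fst
  have e1 : condDistrib Z X μ =ᵐ[μ.map X] (condDistrib Y X μ).map (fun y => y.2.1) :=
    condDistrib_comp X hYm.aemeasurable (f := fun y => y.2.1) (by fun_prop)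
  have e2 : ∀ k, condDistrib (ε k) X μ =ᵐ[μ.map X] (condDistrib Y X μ).map (fun y => y.2.2 k) :=
    fun k => condDistrib_comp X hYm.aemeasurable (f := fun y => y.2.2 k) (by fun_prop)
  have e3 : condDistrib Z₀ X μ =ᵐ[μ.map X] Kernel.const β γ := by
    refine condDistrib_ae_eq_of_measure_eq_compProd X hZ₀.aemeasurable ?_
    rw [hlaw, Measure.compProd_const]
  have e4 : ∀ᵐ x ∂(μ.map X), ∀ᵐ y ∂(condDistrib Y X μ x),
      |y.2.1 - y.1| ≤ a * |y.1| + b + c * ∑ k, |y.2.2 k| := by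
    have h1 : ∀ᵐ p ∂((μ.map X) ⊗ₘ condDistrib Y X μ),
        |p.2.2.1 - p.2.1| ≤ a * |p.2.1| + b + c * ∑ k, |p.2.2.2 k| := by
      rw [compProd_map_condDistrib hYm.aemeasurable, ae_map_iff (hX.prodMk hYm).aemeasurable
        (measurableSet_le (by fun_prop) (by fun_prop))]
      exact hbound
    exact Measure.ae_ae_of_ae_compProd h1
  have e5 := ae_of_ae_map hX.aemeasurable
    (e0.and (e1.and ((ae_all_iff.2 e2).and (e3.and e4))))
  filter_upwards [e5] with ω hω f L C m hf hfC hm hεm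
  obtain ⟨h0, h1, h2, h3, h4⟩ := hω
  set κ := condDistrib Y X μ (X ω) with hκ
  have hfst : κ.map Prod.fst = γ := by
    rw [← Kernel.map_apply _ measurable_fst, ← h0, h3, Kernel.const_apply]
  have hmZ : Measurable fun y : ℝ × ℝ × (Fin K → ℝ) => y.2.1 := by fun_prop
  have hsnd : κ.map (fun y => y.2.1) = condDistrib Z X μ (X ω) := by
    rw [← Kernel.map_apply _ hmZ, ← h1]
  have hmε : ∀ k, Measurable fun y : ℝ × ℝ × (Fin K → ℝ) => y.2.2 k := fun k => by fun_prop
  have hthd : ∀ k, κ.map (fun y => y.2.2 k) = condDistrib (ε k) X μ (X ω) := fun k => by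
    rw [← Kernel.map_apply _ (hmε k), ← h2 k]
  have hfm : Measurable f := hf.continuous.measurable
  have hfint : ∀ {g : ℝ × ℝ × (Fin K → ℝ) → ℝ}, Measurable g → Integrable (fun y => f (g y)) κ := by
    intro g hg
    refine Integrable.of_bound (hfm.comp hg).aestronglyMeasurable (C + |f 0|)
      (ae_of_all _ fun y => ?_)
    have := hfC (g y) 0
    rw [Real.dist_eq] at this
    calc ‖f (g y)‖ = |(f (g y) - f 0) + f 0| := by rw [sub_add_cancel, Real.norm_eq_abs]
      _ ≤ _ := (abs_add_le _ _).trans (by linarith)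
  have hγabs : ∫⁻ z, ENNReal.ofReal |z| ∂γ = ENNReal.ofReal (∫ z, |z| ∂γ) :=
    (ofReal_integral_eq_lintegral_ofReal hγ.abs (ae_of_all _ fun z => abs_nonneg z)).symm
  have hγ0 : 0 ≤ ∫ z, |z| ∂γ := integral_nonneg fun z => abs_nonneg z
  have hsum0 : 0 ≤ ∑ k, m k := Finset.sum_nonneg fun k _ => hm k
  rw [← hsnd, ← hfst, integral_map hmZ.aemeasurable hfm.aestronglyMeasurable,
    integral_map measurable_fst.aemeasurable hfm.aestronglyMeasurable,
    ← integral_sub (hfint hmZ) (hfint measurable_fst), hfst]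
  rw [← Real.norm_eq_abs]
  refine (norm_integral_le_lintegral_norm _).trans (ENNReal.toReal_le_of_le_ofReal
    (by positivity) ?_)
  calc ∫⁻ y, ENNReal.ofReal ‖f y.2.1 - f y.1‖ ∂κ
      ≤ ∫⁻ y, ENNReal.ofReal L * (ENNReal.ofReal a * ENNReal.ofReal |y.1| + ENNReal.ofReal b +
          ENNReal.ofReal c * ∑ k, ENNReal.ofReal |y.2.2 k|) ∂κ := by
        refine lintegral_mono_ae ?_
        filter_upwards [h4] with y hy
        have hs : 0 ≤ ∑ k, |y.2.2 k| := Finset.sum_nonneg fun k _ => abs_nonneg _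
        rw [← ENNReal.ofReal_sum_of_nonneg (fun k _ => abs_nonneg _), ← ENNReal.ofReal_mul ha,
          ← ENNReal.ofReal_mul hc, ← ENNReal.ofReal_add (by positivity) hb,
          ← ENNReal.ofReal_add (by positivity) (by positivity), ← ENNReal.ofReal_mul L.coe_nonneg]
        refine ENNReal.ofReal_le_ofReal ?_
        rw [Real.norm_eq_abs, ← Real.dist_eq]
        refine (hf.dist_le_mul _ _).trans ?_
        rw [Real.dist_eq]
        gcongr
    _ = ENNReal.ofReal L * (ENNReal.ofReal a * ENNReal.ofReal (∫ z, |z| ∂γ) + ENNReal.ofReal b +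
          ENNReal.ofReal c * ∑ k, ∫⁻ z, ENNReal.ofReal |z| ∂(condDistrib (ε k) X μ (X ω))) := by
        rw [lintegral_const_mul _ (by fun_prop), lintegral_add_left (by fun_prop),
          lintegral_add_left (by fun_prop), lintegral_const_mul _ (by fun_prop),
          lintegral_const_mul _ (by fun_prop), lintegral_finsetSum _ (by fun_prop),
          lintegral_const, measure_univ, mul_one, ← hγabs]
        congr 4
        · rw [← hfst, lintegral_map (by fun_prop) measurable_fst]
        · funext k
          rw [← hthd k, lintegral_map (by fun_prop) (hmε k)]
    _ ≤ ENNReal.ofReal L * (ENNReal.ofReal a * ENNReal.ofReal (∫ z, |z| ∂γ) + ENNReal.ofReal b +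
          ENNReal.ofReal c * ∑ k, ENNReal.ofReal (m k)) := by
        gcongr with k
        exact hεm k
    _ = _ := by
        rw [← ENNReal.ofReal_sum_of_nonneg (fun k _ => hm k), ← ENNReal.ofReal_mul ha,
          ← ENNReal.ofReal_mul hc, ← ENNReal.ofReal_add (by positivity) hb,
          ← ENNReal.ofReal_add (by positivity) (by positivity), ← ENNReal.ofReal_mul L.coe_nonneg]

end Comparison

/-! ### Decomposition of the normalized error -/

/-- The normalized error is the normalized noise up to relative errors of the recovered
information and the quantization errors of the statistics `V^k`. -/
theorem abs_normalizedError_sub_le {K : ℕ} {D : Design K} {σ : Fin K → ℝ} (x : ℂ)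
    {H : Fin K → ℕ → ℂ} (W : Fin K → ℕ → ℂ) {Δ : ℝ} (hI : 0 < D.target)
    (hŨ : D.target ≤ fusedU D σ H (stopTime D σ H))
    (hU0 : 0 < condFisherInfo σ H (stopTime D σ H))
    (hU : condFisherInfo σ H (stopTime D σ H) ≤ 3 * D.target)
    (hΔ : |fusedU D σ H (stopTime D σ H) - condFisherInfo σ H (stopTime D σ H)| ≤ Δ) :
    |normalizedError D σ x H W - fusedNoise σ H W (stopTime D σ H) /
        √(condFisherInfo σ H (stopTime D σ H))| ≤
      Δ / D.target * |fusedNoise σ H W (stopTime D σ H) /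
        √(condFisherInfo σ H (stopTime D σ H))| + |x.re| * (√(3 * D.target) * (Δ / D.target)) +
      √(3 * D.target) / D.target * ∑ k, |quantV D σ x H W k - stoppedV D σ x H W k| := by
  rw [normalizedError, estimate]
  have hsum : ∑ k, quantV D σ x H W k = x.re * condFisherInfo σ H (stopTime D σ H) +
      fusedNoise σ H W (stopTime D σ H) + ∑ k, (quantV D σ x H W k - stoppedV D σ x H W k) := by
    rw [← sum_localV, Finset.sum_sub_distrib]
    simp only [stoppedV]
    ring
  have habs := Finset.abs_sum_le_sum_abs
    (fun k => quantV D σ x H W k - stoppedV D σ x H W k) Finset.univ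
  rw [hsum]
  set U := condFisherInfo σ H (stopTime D σ H)
  set V := fusedU D σ H (stopTime D σ H)
  set N := fusedNoise σ H W (stopTime D σ H)
  set S := ∑ k, (quantV D σ x H W k - stoppedV D σ x H W k)
  set I := D.target
  have hV : 0 < V := hI.trans_le hŨ
  have hsq : 0 < √U := Real.sqrt_pos.2 hU0
  have hsq' : √U ≤ √(3 * I) := Real.sqrt_le_sqrt hU
  have hΔ0 : 0 ≤ Δ := (abs_nonneg _).trans hΔ
  have hrel : |(V - U) / V| ≤ Δ / I := by
    rw [abs_div, abs_of_pos hV]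
    gcongr
  have key : √U * ((x.re * U + N + S) / V - x.re) - N / √U =
      -((V - U) / V) * (N / √U) + -(x.re * (√U * ((V - U) / V))) + √U / V * S := by
    have hUs : U = √U * √U := (Real.mul_self_sqrt hU0.le).symm
    have hcancel : N = √U * (N / √U) := by field_simp
    generalize N / √U = n at *
    rw [hcancel]
    clear_value U V
    field_simp
    linear_combination -n * hUs
  rw [key]
  refine (abs_add_le _ _).trans (add_le_add ((abs_add_le _ _).trans (add_le_add ?_ ?_)) ?_)
  · rw [abs_mul, abs_neg]
    gcongr
  · rw [abs_neg, abs_mul, abs_mul, abs_of_pos hsq]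
    gcongr
  · rw [abs_mul, abs_of_pos (by positivity)]
    gcongr

/-! ### The asymptotic regime -/

theorem eventually_sq_le_two_pow {u : ℕ → ℝ} {n : ℕ → ℕ} (hu : Tendsto u atTop atTop)
    (h : (fun j => Real.log (u j)) =o[atTop] fun j => (n j : ℝ)) :
    ∀ᶠ j in atTop, u j ^ 2 ≤ 2 ^ n j := by
  have hlog2 : 0 < Real.log 2 := Real.log_pos one_lt_two
  filter_upwards [h.bound (half_pos hlog2), hu.eventually_gt_atTop 0] with j hj h0
  rw [Real.norm_eq_abs, Real.norm_natCast] at hj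
  have h1 := (le_abs_self _).trans hj
  rw [← Real.log_le_log_iff (by positivity) (by positivity), Real.log_pow, Real.log_pow]
  push_cast
  linarith

theorem tendsto_atTop_of_log_isLittleO {u : ℕ → ℝ} {n : ℕ → ℕ} (hu : Tendsto u atTop atTop)
    (h : (fun j => Real.log (u j)) =o[atTop] fun j => (n j : ℝ)) : Tendsto n atTop atTop := by
  rw [← tendsto_natCast_atTop_iff (R := ℝ)]
  refine tendsto_atTop_mono' _ ?_ (Real.tendsto_log_atTop.comp hu)
  filter_upwards [h.bound one_pos] with j hj
  rw [Real.norm_eq_abs, Real.norm_natCast, one_mul] at hj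
  exact (le_abs_self _).trans hj

theorem tendsto_sqrt_div_atTop {I e : ℕ → ℝ} (hI : Tendsto I atTop atTop)
    (he : Tendsto e atTop atTop) (h : e =o[atTop] fun j => √(I j)) :
    Tendsto (fun j => √(I j) / e j) atTop atTop := by
  have h0 := h.tendsto_div_nhds_zero
  have h1 : Tendsto (fun j => e j / √(I j)) atTop (𝓝[>] 0) := by
    refine tendsto_nhdsWithin_iff.2 ⟨h0, ?_⟩
    filter_upwards [hI.eventually_gt_atTop 0, he.eventually_gt_atTop 0] with j h2 h3
    exact div_pos h3 (Real.sqrt_pos.2 h2)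
  refine h1.inv_tendsto_nhdsGT_zero.congr fun j => ?_
  simp

/-- The number of messages up to the target is of order `I / e` and each carries an error of order
`2⁻ʳ`; the total is negligible with respect to `√I`. -/
theorem tendsto_sqrt_mul_error {I e : ℕ → ℝ} {r : ℕ → ℕ} (C : ℝ) (hI : Tendsto I atTop atTop)
    (he : Tendsto e atTop atTop) (h : e =o[atTop] fun j => √(I j))
    (hr : (fun j => Real.log (√(I j) / e j)) =o[atTop] fun j => (r j : ℝ)) :
    Tendsto (fun j => √(I j) * (C / 2 ^ r j / e j)) atTop (𝓝 0) := by
  have hρ := tendsto_sqrt_div_atTop hI he h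
  have h1 : Tendsto (fun j => |C| / (√(I j) / e j)) atTop (𝓝 0) :=
    tendsto_const_nhds.div_atTop hρ
  refine squeeze_zero_norm' ?_ h1
  filter_upwards [eventually_sq_le_two_pow hρ hr, hρ.eventually_gt_atTop 0] with j h2 h3
  have h4 : √(I j) * (C / 2 ^ r j / e j) = C * ((√(I j) / e j) / 2 ^ r j) := by ring
  rw [h4, Real.norm_eq_abs, abs_mul, abs_of_pos (div_pos h3 (by positivity)), div_eq_mul_inv |C|]
  gcongr
  rw [div_le_iff₀ (by positivity), ← div_eq_inv_mul, le_div_iff₀ h3]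
  nlinarith

/-! ### The conditional law of the normalized error -/

section Main

variable {Ω : Type*} [MeasurableSpace Ω] {μ : Measure Ω} [IsProbabilityMeasure μ] {K : ℕ}
  {σ : Fin K → ℝ} {h w : Ω → Fin K → ℕ → ℂ}

theorem measurable_normalizedNoise {α : Type*} [MeasurableSpace α] (D : Design K) (σ : Fin K → ℝ)
    {H W : α → Fin K → ℕ → ℂ} (hH : Measurable H) (hW : Measurable W) :
    Measurable fun p => fusedNoise σ (H p) (W p) (stopTime D σ (H p)) /
      √(condFisherInfo σ (H p) (stopTime D σ (H p))) :=
  (measurable_apply_nat (fun t => measurable_fusedNoise σ hH hW t)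
    (measurable_stopTime D σ hH)).div
    (measurable_apply_nat (measurable_condFisherInfo σ hH) (measurable_stopTime D σ hH)).sqrt

/-- The comparison of conditional laws, applied to the normalized error and the normalized noise;
given the channel gains the latter is standard normal. -/
theorem abs_integral_condLaw_sub_le (x : ℂ) (hσ : ∀ k, 0 < σ k) (hh : Measurable h)
    (hw : Measurable w) (w_indep : iIndepFun (fun (i : Fin K × ℕ) ω => w ω i.1 i.2) μ)
    (w_law : ∀ k τ, μ.map (fun ω => w ω k τ) = complexGaussian (Real.toNNReal (σ k ^ 2)))
    (h_indep_w : IndepFun h w μ) (D : Design K) {a b c : ℝ} (ha : 0 ≤ a) (hb : 0 ≤ b) (hc : 0 ≤ c)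
    (hpos : ∀ᵐ ω ∂μ, 0 < condFisherInfo σ (h ω) (stopTime D σ (h ω)))
    (hbound : ∀ᵐ ω ∂μ, |normalizedError D σ x (h ω) (w ω) -
        fusedNoise σ (h ω) (w ω) (stopTime D σ (h ω)) /
          √(condFisherInfo σ (h ω) (stopTime D σ (h ω)))| ≤
      a * |fusedNoise σ (h ω) (w ω) (stopTime D σ (h ω)) /
          √(condFisherInfo σ (h ω) (stopTime D σ (h ω)))| + b +
        c * ∑ k, |quantV D σ x (h ω) (w ω) k - stoppedV D σ x (h ω) (w ω) k|) :
    ∀ᵐ ω ∂μ, ∀ (f : ℝ → ℝ) (L : ℝ≥0) (C : ℝ) (m : Fin K → ℝ), LipschitzWith L f →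
      (∀ x y, dist (f x) (f y) ≤ C) → (∀ k, 0 ≤ m k) →
      (∀ k, ∫⁻ z, ENNReal.ofReal |z| ∂(condLaw μ D σ h
        (fun ω' => quantV D σ x (h ω') (w ω') k - stoppedV D σ x (h ω') (w ω') k) ω : Measure ℝ)
          ≤ ENNReal.ofReal (m k)) →
      |∫ z, f z ∂(condLaw μ D σ h (fun ω' => normalizedError D σ x (h ω') (w ω')) ω : Measure ℝ)
          - ∫ z, f z ∂(stdNormal : Measure ℝ)| ≤
        L * (a * ∫ z, |z| ∂(gaussianReal 0 1) + b + c * ∑ k, m k) := by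
  refine abs_integral_condDistrib_sub_le (measurable_history D σ hh)
    (measurable_normalizedNoise D σ hh hw)
    (measurable_normalizedError D σ x hh hw)
    (fun k => (measurable_quantV D σ x hh hw k).sub (measurable_stoppedV D σ x hh hw k))
    ((memLp_id_gaussianReal 1).integrable le_rfl) ?_ ha hb hc hbound
  refine map_prodMk_eq_prod_of_indepFun hh hw h_indep_w (G := history D σ)
    (F := fun H W => fusedNoise σ H W (stopTime D σ H) / √(condFisherInfo σ H (stopTime D σ H)))
    (measurable_history D σ measurable_id)
    (measurable_normalizedNoise D σ measurable_fst measurable_snd) ?_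
  filter_upwards [hpos] with ω hω
  exact map_fusedNoise_div_sqrt hσ hw w_indep w_law (h ω) _ hω

end Main

theorem isRenewalSequence_gain {Ω : Type*} [MeasurableSpace Ω] {μ : Measure Ω} {K : ℕ}
    {σ : Fin K → ℝ} {h : Ω → Fin K → ℕ → ℂ} (k : Fin K) (hσ : 0 < σ k) (hh : Measurable h)
    (h_indep : iIndepFun (fun τ ω => h ω k τ) μ)
    (h_ident : ∀ τ, IdentDistrib (fun ω => h ω k τ) (fun ω => h ω k 0) μ μ)
    (hA2 : ∀ τ, ∀ᵐ ω ∂μ, 0 < ‖h ω k τ‖) :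
    IsRenewalSequence μ fun τ ω => 2 * ‖h ω k τ‖ ^ 2 / σ k ^ 2 := by
  have hm : Measurable fun z : ℂ => 2 * ‖z‖ ^ 2 / σ k ^ 2 := by fun_prop
  refine ⟨fun τ => hm.comp (measurable_entry hh k τ), h_indep.comp _ fun _ => hm,
    fun τ => (h_ident τ).comp hm, ?_⟩
  filter_upwards [ae_all_iff.2 hA2] with ω hω τ
  have := hω τ
  positivity

/-- By the strong law of large numbers the time is at most proportional to the information
collected, up to a random constant. -/
theorem IsRenewalSequence.ae_exists_le_walk {Ω : Type*} [MeasurableSpace Ω] {μ : Measure Ω}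
    [IsProbabilityMeasure μ] {X : ℕ → Ω → ℝ} (hX : IsRenewalSequence μ X)
    (hint : Integrable (X 0) μ) :
    ∀ᵐ ω ∂μ, ∃ a b : ℝ, 0 ≤ a ∧ 0 ≤ b ∧ ∀ n : ℕ, (n : ℝ) ≤ a + b * walk X n ω := by
  have hm := hX.integral_pos hint
  filter_upwards [hX.ae_tendsto_walk_div hint, hX.monotone_walk] with ω hω hmono
  set m := ∫ ω, X 0 ω ∂μ
  obtain ⟨N, hN⟩ := eventually_atTop.1
    ((hω.eventually_const_le (half_lt_self hm)).and (eventually_gt_atTop 0))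
  refine ⟨N, 2 / m, by positivity, by positivity, fun n => ?_⟩
  rcases le_or_gt N n with h | h
  · obtain ⟨h1, h2⟩ := hN n h
    have h3 : (0 : ℝ) < n := by exact_mod_cast h2
    rw [le_div_iff₀ h3] at h1
    have h4 : (n : ℝ) ≤ 2 / m * walk X n ω := by
      rw [div_mul_eq_mul_div, le_div_iff₀ hm]; linarith
    have h5 : (0 : ℝ) ≤ N := by positivity
    linarith
  · have h1 : (n : ℝ) ≤ N := by exact_mod_cast h.le
    have h2 : 0 ≤ walk X n ω := by
      have := hmono (Nat.zero_le n)
      simpa [walk] using this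
    have h3 : 0 ≤ 2 / m * walk X n ω := by positivity
    linarith

/-- The consequences of the error bounds at one fixed design whose target is large: control of
the information just before the stopping time, and of the conditional law of the normalized
error. -/
theorem ae_condLaw_normalizedError_bound {Ω : Type*} [MeasurableSpace Ω] {μ : Measure Ω}
    [IsProbabilityMeasure μ] {K : ℕ} (hK : 0 < K) {σ : Fin K → ℝ} {h w : Ω → Fin K → ℕ → ℂ}
    (x : ℂ) (hσ : ∀ k, 0 < σ k) (hh : Measurable h)
    (hw : Measurable w) (w_indep : iIndepFun (fun (i : Fin K × ℕ) ω => w ω i.1 i.2) μ)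
    (w_law : ∀ k τ, μ.map (fun ω => w ω k τ) = complexGaussian (Real.toNNReal (σ k ^ 2)))
    (h_indep_w : IndepFun h w μ) (D : Design K) {B δ : Fin K → ℝ}
    (htop : ∀ k, ∀ᵐ ω ∂μ, Tendsto (localU σ (h ω) k) atTop atTop)
    (hI : 0 < D.target) (he : ∀ k, 0 < D.e k) (hφ : ∀ k, 0 ≤ D.φ k) (hδ : ∀ k, 0 ≤ δ k)
    (hη : ∑ k, δ k / D.e k ≤ 1 / 4) (hE : ∑ k, D.e k ≤ D.target / 4)
    (hB : ∑ k, B k ≤ D.target)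
    (hstep : ∀ k, ∀ᵐ ω ∂μ, ∀ τ, 2 * ‖h ω k τ‖ ^ 2 / σ k ^ 2 ≤ B k)
    (hq : ∀ k, ∀ᵐ ω ∂μ, ∀ n, 1 ≤ n →
      |quantOvershoot (localU σ (h ω) k) (D.e k) (D.θ k) D.rU n
        - overshoot (localU σ (h ω) k) (D.e k) n| ≤ δ k)
    (hV : FinalQuantizersOK μ D σ x h w) :
    ∀ᵐ ω ∂μ, condFisherInfo σ (h ω) (stopTime D σ (h ω) - 1) ≤ 2 * D.target ∧
      ∀ (f : ℝ → ℝ) (L : ℝ≥0) (c : ℝ), LipschitzWith L f → (∀ x y, dist (f x) (f y) ≤ c) →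
        |∫ z, f z ∂(condLaw μ D σ h
          (fun ω' => normalizedError D σ x (h ω') (w ω')) ω : Measure ℝ)
            - ∫ z, f z ∂(stdNormal : Measure ℝ)| ≤
          L * ((∑ k, D.e k + 3 * D.target * ∑ k, δ k / D.e k) / D.target *
              ∫ z, |z| ∂(gaussianReal 0 1) +
            |x.re| * (√(3 * D.target) *
              ((∑ k, D.e k + 3 * D.target * ∑ k, δ k / D.e k) / D.target)) +
            √(3 * D.target) / D.target * ∑ k, stopTime D σ (h ω) * D.φ k / 2 ^ D.R k) := by
  have hη0 : 0 ≤ ∑ k, δ k / D.e k :=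
    Finset.sum_nonneg fun k _ => div_nonneg (hδ k) (he k).le
  have hE0 : 0 ≤ ∑ k, D.e k := Finset.sum_nonneg fun k _ => (he k).le
  set Δ := ∑ k, D.e k + 3 * D.target * ∑ k, δ k / D.e k with hΔ
  have hΔ0 : 0 ≤ Δ := by positivity
  have hpath : ∀ᵐ ω ∂μ, (D.target ≤ fusedU D σ (h ω) (stopTime D σ (h ω)) ∧
      condFisherInfo σ (h ω) (stopTime D σ (h ω) - 1) ≤ 2 * D.target ∧
      condFisherInfo σ (h ω) (stopTime D σ (h ω)) ≤ 3 * D.target ∧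
      D.target / 2 ≤ condFisherInfo σ (h ω) (stopTime D σ (h ω))) ∧
      |fusedU D σ (h ω) (stopTime D σ (h ω)) - condFisherInfo σ (h ω) (stopTime D σ (h ω))|
        ≤ Δ := by
    filter_upwards [ae_all_iff.2 htop, ae_all_iff.2 hstep, ae_all_iff.2 hq] with ω h1 h2 h3
    have hbd := abs_fusedU_sub_le h1 he hδ h3
    have htopU : Tendsto (condFisherInfo σ (h ω)) atTop atTop :=
      tendsto_atTop_mono (fun t => Finset.single_le_sum (f := fun k => localU σ (h ω) k t)
        (fun k _ => localU_nonneg k t) (Finset.mem_univ (⟨0, hK⟩ : Fin K))) (h1 ⟨0, hK⟩)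
    have hspec := stopTime_spec hη hE hB hI htopU hbd
      (fun t => Finset.sum_le_sum fun k _ => h2 k t)
    refine ⟨hspec, (hbd _).trans ?_⟩
    rw [hΔ]
    gcongr
    exact hspec.2.2.1
  have hcond := abs_integral_condLaw_sub_le x hσ hh hw w_indep w_law h_indep_w D
    (a := Δ / D.target) (b := |x.re| * (√(3 * D.target) * (Δ / D.target)))
    (c := √(3 * D.target) / D.target) (by positivity) (by positivity) (by positivity)
    (hpath.mono fun ω hω => (half_pos hI).trans_le hω.1.2.2.2)
    (hpath.mono fun ω hω => abs_normalizedError_sub_le x (w ω) hI hω.1.1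
      ((half_pos hI).trans_le hω.1.2.2.2) hω.1.2.2.1 hω.2)
  filter_upwards [hpath, hcond, ae_all_iff.2 hV] with ω h1 h2 h3
  refine ⟨h1.1.2.1, fun f L c hf hc => ?_⟩
  refine h2 f L c (fun k => stopTime D σ (h ω) * D.φ k / 2 ^ D.R k) hf hc (fun k => ?_)
    fun k => (h3 k).le
  have := hφ k
  positivity

end LTsDMLE

theorem theorem5 {Ω : Type*} [MeasurableSpace Ω] (μ : Measure Ω) [IsProbabilityMeasure μ]
    {K : ℕ} (hK : 0 < K)
    -- the parameter, the noise levels, the channel gains and the noise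
    (x : ℂ) (σ : Fin K → ℝ) (h w : Ω → Fin K → ℕ → ℂ)
    (hσ : ∀ k, 0 < σ k) (hh : Measurable h) (hw : Measurable w)
    -- the gains are i.i.d. across time at each sensor
    (h_indep : ∀ k, iIndepFun (fun τ ω => h ω k τ) μ)
    (h_ident : ∀ k τ, IdentDistrib (fun ω => h ω k τ) (fun ω => h ω k 0) μ μ)
    -- the noise: independent across time and sensors, `N_c(0, σ_k ^ 2)` at sensor `k`
    (w_indep : iIndepFun (fun (i : Fin K × ℕ) ω => w ω i.1 i.2) μ)
    (w_law : ∀ k τ, μ.map (fun ω => w ω k τ) = LTsDMLE.complexGaussian (Real.toNNReal (σ k ^ 2)))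
    (h_indep_w : IndepFun h w μ)
    -- (A1), (A2)
    (hA1 : 0 < |x.re| ∧ 0 < |x.im|)
    (hA2 : ∀ k τ, ∀ᵐ ω ∂μ, 0 < ‖h ω k τ‖)
    -- the designs, indexed along an arbitrary sequence of targets tending to infinity;
    -- the quantizer ranges `θ_k`, `φ_k` do not depend on the target
    (D : ℕ → LTsDMLE.Design K) (θ φ : Fin K → ℝ)
    (hθ : ∀ k, 0 < θ k) (hφ : ∀ k, 0 < φ k)
    (hDθ : ∀ j, (D j).θ = θ) (hDφ : ∀ j, (D j).φ = φ)
    (hDU : ∀ᶠ j in atTop, LTsDMLE.OvershootQuantizersOK μ (D j) σ h)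
    (hDV : ∀ᶠ j in atTop, LTsDMLE.FinalQuantizersOK μ (D j) σ x h w)
    -- the asymptotic regime
    (h_target : Tendsto (fun j => (D j).target) atTop atTop)
    (h_R : ∀ k, (fun j => Real.log (D j).target) =o[atTop] (fun j => ((D j).R k : ℝ)))
    (h_e : ∀ k, Tendsto (fun j => (D j).e k) atTop atTop)
    (h_e' : ∀ k, (fun j => (D j).e k) =o[atTop] (fun j => Real.sqrt (D j).target))
    (h_rU : ∀ k, (fun j => Real.log (Real.sqrt (D j).target / (D j).e k))
      =o[atTop] (fun j => ((D j).rU : ℝ))) :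
    ∀ᵐ ω ∂μ, Tendsto
      (fun j => LTsDMLE.condLaw μ (D j) σ h
        (fun ω' => LTsDMLE.normalizedError (D j) σ x (h ω') (w ω')) ω)
      atTop (𝓝 LTsDMLE.stdNormal) := by
  open LTsDMLE in
  set I : ℕ → ℝ := fun j => (D j).target with hI
  have hX := fun k => isRenewalSequence_gain k (hσ k) hh (h_indep k) (h_ident k) (hA2 k)
  have k₀ : Fin K := ⟨0, hK⟩
  have h_r : Tendsto (fun j => (D j).rU) atTop atTop :=
    tendsto_atTop_of_log_isLittleO (tendsto_sqrt_div_atTop h_target (h_e k₀) (h_e' k₀)) (h_rU k₀)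
  -- integrability of the gains and almost sure error bounds, sensor by sensor
  have hsensor := fun k => (hX k).exists_quantization_error_bound (hθ k) (h_e k) h_r (by
    filter_upwards [hDU] with j hj n hn
    have := hj k n hn
    rw [hDθ] at this
    exact this)
  have hint := fun k => (hsensor k).1
  choose B C hC hBC using fun k => (hsensor k).2
  -- the two parts of the bound on `|fusedU - condFisherInfo|`
  set E : ℕ → ℝ := fun j => ∑ k, (D j).e k with hE
  set η : ℕ → ℝ := fun j => ∑ k, C k / 2 ^ (D j).rU / (D j).e k with hη
  have hsqrtI : Tendsto (fun j => √(I j)) atTop atTop := Real.tendsto_sqrt_atTop.comp h_target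
  have hinv : Tendsto (fun j => (√(I j))⁻¹) atTop (𝓝 0) := tendsto_inv_atTop_zero.comp hsqrtI
  have hE0 : Tendsto (fun j => E j / √(I j)) atTop (𝓝 0) := by
    have := tendsto_finsetSum Finset.univ fun k (_ : k ∈ Finset.univ) =>
      (h_e' k).tendsto_div_nhds_zero
    simpa [hE, Finset.sum_div] using this
  have hη0 : Tendsto (fun j => √(I j) * η j) atTop (𝓝 0) := by
    have := tendsto_finsetSum Finset.univ fun k (_ : k ∈ Finset.univ) =>
      tendsto_sqrt_mul_error (C k) h_target (h_e k) (h_e' k) (h_rU k)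
    simpa [hη, Finset.mul_sum] using this
  set d : ℕ → ℝ := fun j => E j / √(I j) + 3 * (√(I j) * η j) with hd
  have hd0 : Tendsto d atTop (𝓝 0) := by
    simpa using hE0.add (hη0.const_mul 3)
  have hgood : ∀ᶠ j in atTop, 1 ≤ I j ∧ (∀ k, 0 < (D j).e k) ∧ η j ≤ 1 / 4 ∧ E j ≤ I j / 4 ∧
      ∑ k, B k ≤ I j ∧ (∀ k, (∀ᵐ ω ∂μ, ∀ i, 2 * ‖h ω k i‖ ^ 2 / σ k ^ 2 ≤ B k) ∧
        ∀ᵐ ω ∂μ, ∀ n, 1 ≤ n →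
          |quantOvershoot (localU σ (h ω) k) ((D j).e k) (θ k) (D j).rU n
            - overshoot (localU σ (h ω) k) ((D j).e k) n| ≤ C k / 2 ^ (D j).rU) ∧
      FinalQuantizersOK μ (D j) σ x h w ∧ (∀ k, I j ^ 2 ≤ 2 ^ (D j).R k) := by
    have h1 : ∀ᶠ j in atTop, η j ≤ 1 / 4 := by
      have : Tendsto (fun j => (√(I j))⁻¹ * (√(I j) * η j)) atTop (𝓝 0) := by
        simpa using hinv.mul hη0
      filter_upwards [this.eventually_le_const (show (0 : ℝ) < 1 / 4 by norm_num),
        hsqrtI.eventually_gt_atTop 0] with j h2 h3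
      rwa [inv_mul_cancel_left₀ h3.ne'] at h2
    have h2 : ∀ᶠ j in atTop, E j ≤ I j / 4 := by
      filter_upwards [hE0.eventually_le_const (show (0 : ℝ) < 1 by norm_num),
        hsqrtI.eventually_ge_atTop 4, h_target.eventually_ge_atTop 0] with j h3 h4 h5
      rw [div_le_one (by linarith)] at h3
      have := Real.mul_self_sqrt h5
      change √(I j) * √(I j) = I j at this
      nlinarith
    filter_upwards [h_target.eventually_ge_atTop 1,
      eventually_all.2 fun k => (h_e k).eventually_gt_atTop 0, h1, h2,
      h_target.eventually_ge_atTop (∑ k, B k), eventually_all.2 hBC, hDV,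
      eventually_all.2 fun k => eventually_sq_le_two_pow h_target (h_R k)]
      with j a1 a2 a3 a4 a5 a6 a7 a8
    exact ⟨a1, a2, a3, a4, a5, a6, a7, a8⟩
  have hgrow : ∀ᵐ ω ∂μ, ∃ a b : ℝ, 0 ≤ a ∧ 0 ≤ b ∧ ∀ n : ℕ, (n : ℝ) ≤ a + b * localU σ (h ω) k₀ n :=
    (hX k₀).ae_exists_le_walk (hint k₀)
  obtain ⟨J, hJ⟩ := eventually_atTop.1 hgood
  have hfixed := ae_all_iff.2 fun j : {j // J ≤ j} => by
    obtain ⟨a1, a2, a3, a4, a5, a6, a7, a8⟩ := hJ j.1 j.2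
    exact ae_condLaw_normalizedError_bound hK x hσ hh hw w_indep w_law h_indep_w (D j.1) (B := B)
      (δ := fun k => C k / 2 ^ (D j.1).rU) (fun k => (hX k).ae_tendsto_walk_atTop (hint k))
      (one_pos.trans_le a1) a2 (fun k => by rw [hDφ]; exact (hφ k).le)
      (fun k => div_nonneg (hC k) (by positivity)) a3 a4 a5 (fun k => (a6 k).1)
      (fun k => by rw [hDθ]; exact (a6 k).2) a7
  filter_upwards [hgrow, hfixed] with ω hω1 hω2
  obtain ⟨a, b, ha, hb, hab⟩ := hω1
  rw [tendsto_iff_forall_lipschitz_integral_tendsto]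
  rintro f ⟨c, hc⟩ ⟨L, hL⟩
  rw [tendsto_iff_norm_sub_tendsto_zero]
  -- deterministic upper bound for the distance, given the random constants `a` and `b`
  have hlim : Tendsto (fun j => L * (d j * (√(I j))⁻¹ * ∫ z, |z| ∂(gaussianReal 0 1) +
      |x.re| * (√3 * d j) + √3 * (√(I j))⁻¹ * ∑ k, (1 + a + 2 * b) * φ k)) atTop (𝓝 0) := by
    have h1 := ((hd0.mul hinv).mul_const (∫ z, |z| ∂(gaussianReal 0 1))).add
      ((hd0.const_mul √3).const_mul |x.re|)
    have h2 := (h1.add ((hinv.const_mul √3).mul_const (∑ k, (1 + a + 2 * b) * φ k))).const_mul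
      (L : ℝ)
    simpa using h2
  refine squeeze_zero' (Eventually.of_forall fun j => norm_nonneg _) ?_ hlim
  filter_upwards [eventually_ge_atTop J] with j hj
  obtain ⟨hT, hdist⟩ := hω2 ⟨j, hj⟩
  obtain ⟨a1, a2, a3, a4, a5, a6, a7, a8⟩ := hJ j hj
  change condFisherInfo σ (h ω) (stopTime (D j) σ (h ω) - 1) ≤ 2 * I j at hT
  refine (hdist f L c hL hc).trans ?_
  change L * ((E j + 3 * I j * η j) / I j * _ +
    |x.re| * (√(3 * I j) * ((E j + 3 * I j * η j) / I j))
    + √(3 * I j) / I j * _) ≤ _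
  have hs : 0 < √(I j) := Real.sqrt_pos.2 (one_pos.trans_le a1)
  have hss : I j = √(I j) * √(I j) := (Real.mul_self_sqrt (zero_le_one.trans a1)).symm
  have e1 : (E j + 3 * I j * η j) / I j = d j * (√(I j))⁻¹ := by
    rw [div_eq_iff (one_pos.trans_le a1).ne']
    calc E j + 3 * I j * η j = E j + 3 * (√(I j) * √(I j)) * η j := by rw [← hss]
      _ = (E j / √(I j) + 3 * (√(I j) * η j)) * (√(I j))⁻¹ * (√(I j) * √(I j)) := by field_simp
      _ = d j * (√(I j))⁻¹ * I j := by rw [← hss]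
  have e2 : √(3 * I j) * (d j * (√(I j))⁻¹) = √3 * d j := by
    rw [Real.sqrt_mul (by norm_num)]; field_simp
  have e3 : √(3 * I j) / I j = √3 * (√(I j))⁻¹ := by
    rw [Real.sqrt_mul (by norm_num), mul_div_assoc, Real.sqrt_div_self']
    simp
  rw [e1, e2, e3]
  gcongr with k
  -- the stopping time is at most of the order of the target, and `2 ^ R` exceeds its square
  have hT' : (stopTime (D j) σ (h ω) : ℝ) ≤ (1 + a + 2 * b) * I j := by
    have h1 := hab (stopTime (D j) σ (h ω) - 1)
    have h2 : localU σ (h ω) k₀ (stopTime (D j) σ (h ω) - 1) ≤ 2 * I j :=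
      (Finset.single_le_sum (f := fun k => localU σ (h ω) k (stopTime (D j) σ (h ω) - 1))
        (fun k _ => localU_nonneg k _) (Finset.mem_univ k₀)).trans hT
    have h3 : (stopTime (D j) σ (h ω) : ℝ) ≤ ((stopTime (D j) σ (h ω) - 1 : ℕ) : ℝ) + 1 := by
      exact_mod_cast (by omega : stopTime (D j) σ (h ω) ≤ stopTime (D j) σ (h ω) - 1 + 1)
    have h4 : b * localU σ (h ω) k₀ (stopTime (D j) σ (h ω) - 1) ≤ b * (2 * I j) := by gcongr
    nlinarith
  rw [hDφ, div_le_iff₀ (by positivity)]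
  have h5 : I j ≤ 2 ^ (D j).R k := by nlinarith [a8 k]
  have h6 := (hφ k).le
  calc (stopTime (D j) σ (h ω) : ℝ) * φ k ≤ (1 + a + 2 * b) * I j * φ k := by gcongr
    _ = (1 + a + 2 * b) * φ k * I j := by ring
    _ ≤ _ := by gcongr
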